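/- For $\eta:\mathbb R\to(0,\infty)$ let $D_\eta=\{(x,y): 0<y<\eta(x)\}$. Consider the non-dimensional irrotational steady water-wave problem over a flat bed (mass flux and gravity equal to $1$) with Bernoulli constant $r\in\mathbb R$: $$\Delta\psi=0 \ \text{ in } D_\eta,\qquad \tfrac12|\nabla\psi|^2+y=r \ \text{ on } y=\eta,\qquad \psi=1\ \text{ on } y=\eta,\qquad \psi=0\ \text{ on } y=0 .$$ A solution is laminar if $\eta$ is constant and $\psi$ depends on $y$ only. For $0<\gamma<1$, $C^{2,\gamma}(\overline{D_\eta})$ and $C^{2,\gamma}(\mathbb R)$ denote the spaces of $C^2$ functions with finite Hölder norm (the function and its derivatives of order at most two are bounded, and the second derivatives are uniformly $\gamma$-Hölder continuous). For $r\ge \tfrac32$ the equation $\tfrac1{2d^2}+d=r$ has exactly the positive roots $d_-(r)\le 1\le d_+(r)$ (with strict inequalities if $r>\tfrac32$); these are the depths of the supercritical and the subcritical laminar flow $\psi=y/d$, $\eta=d$ with Bernoulli constant $r$. Let $\mathcal F_\pm(r)=\frac{1}{2d_\pm(r)}-\frac12 d_\pm(r)^2+r\,d_\pm(r)$ be their flow-force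 constants, and let $F=d^{-3/2}$ be the Froude number of a uniform stream of depth $d$. **Theorem 1.** 1. Let $(\psi,\eta)\in C^{2,\gamma}(\overline{D_\eta})\times C^{2,\gamma}(\mathbb R)$ with $0<\gamma<1$ be a solution that is not laminar. Then the flow force $$\mathcal F=\int_0^{\eta(x)}\Big(\tfrac12(\psi_y^2-\psi_x^2)-y+r\Big)\,dy$$ does not depend on $x$, and $\mathcal F>\tfrac12 r^2$. 2. There is exactly one $r\ge\tfrac32$ with $\mathcal F_-(r)=\tfrac12r^2$. For every $r\ge\tfrac32$, $\mathcal F_-(r)=\tfrac12r^2$ if and only if $d_-(r)^{-3/2}=2$, and $\mathcal F_-(r)>\tfrac12r^2$ if and only if $d_-(r)^{-3/2}<2$. 3. If a solution as in part 1 is a solitary wave, that is, $\eta(x)\to d$ as $|x|\to\infty$, then $d>0$ and its Froude number satisfies $F=d^{-3/2}<2$. 4. For all sufficiently large $r$ one has $\tfrac12r^2<\mathcal F_+(r)$; moreover $\mathcal F_+(r)-\tfrac12r^2\to0$ and, more precisely, $\mathcal F_+(r)=\tfrac12r^2+\tfrac1{2r}+O(r^{-2})$ as $r\to+\infty$. 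-/

import Mathlib

open Set Filter Topology MeasureTheory Asymptotics
open scoped NNReal

noncomputable section

namespace SteadyWave

/-- The class `C^{2,γ}(S)`: `u` is twice continuously differentiable on `S` (up to the boundary
points that belong to `S`), `u` and its derivatives of order at most two are bounded on `S`, and
the second derivative is `γ`-Hölder continuous on `S`. -/
def MemC2Holder {E : Type*} [NormedAddCommGroup E] [NormedSpace ℝ E]
    (γ : ℝ≥0) (S : Set E) (u : E → ℝ) : Prop :=
  ContDiffOn ℝ 2 u S ∧
    ∃ C : ℝ≥0, (∀ k : ℕ, k ≤ 2 → ∀ p ∈ S, ‖iteratedFDerivWithin ℝ k u S p‖ ≤ C) ∧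
      HolderOnWith C γ (iteratedFDerivWithin ℝ 2 u S) S

/-- The open fluid domain `0 < y < η(x)`. -/
def fluid (η : ℝ → ℝ) : Set (ℝ × ℝ) := {p | 0 < p.2 ∧ p.2 < η p.1}

/-- The closed fluid domain `0 ≤ y ≤ η(x)`. -/
def closedFluid (η : ℝ → ℝ) : Set (ℝ × ℝ) := {p | 0 ≤ p.2 ∧ p.2 ≤ η p.1}

/-- The partial derivative with respect to `x` of a function on `S` (one-sided at the boundary). -/
def partialX (S : Set (ℝ × ℝ)) (u : ℝ × ℝ → ℝ) (p : ℝ × ℝ) : ℝ :=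
  fderivWithin ℝ u S p (1, 0)

/-- The partial derivative with respect to `y` of a function on `S` (one-sided at the boundary). -/
def partialY (S : Set (ℝ × ℝ)) (u : ℝ × ℝ → ℝ) (p : ℝ × ℝ) : ℝ :=
  fderivWithin ℝ u S p (0, 1)

/-- The stream-function formulation of the irrotational steady water-wave problem over the flat
bed `y = 0`, with mass flux and gravity equal to `1` and Bernoulli constant `r`. -/
structure IsSolution (r : ℝ) (ψ : ℝ × ℝ → ℝ) (η : ℝ → ℝ) : Prop where
  depth_pos : ∀ x, 0 < η x
  laplace : ∀ p ∈ fluid η,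
    partialX (closedFluid η) (partialX (closedFluid η) ψ) p +
      partialY (closedFluid η) (partialY (closedFluid η) ψ) p = 0
  bernoulli : ∀ x,
    (1 / 2) * (partialX (closedFluid η) ψ (x, η x) ^ 2 +
      partialY (closedFluid η) ψ (x, η x) ^ 2) + η x = r
  top : ∀ x, ψ (x, η x) = 1
  bottom : ∀ x, ψ (x, 0) = 0

/-- A laminar flow (uniform stream): the surface is flat and the stream function depends on `y`
alone. -/
def IsLaminar (ψ : ℝ × ℝ → ℝ) (η : ℝ → ℝ) : Prop :=
  (∃ d : ℝ, ∀ x, η x = d) ∧ ∃ U : ℝ → ℝ, ∀ p ∈ closedFluid η, ψ p = U p.2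

/-- The flow force through the vertical section at `x`. -/
def flowForce (r : ℝ) (ψ : ℝ × ℝ → ℝ) (η : ℝ → ℝ) (x : ℝ) : ℝ :=
  ∫ y in (0 : ℝ)..(η x),
    ((1 / 2) * (partialY (closedFluid η) ψ (x, y) ^ 2 - partialX (closedFluid η) ψ (x, y) ^ 2)
      - y + r)

/-- The flow force of the laminar flow `ψ = y / d`, `η = d` of depth `d`. -/
def laminarFlowForce (r d : ℝ) : ℝ :=
  flowForce r (fun p => p.2 / d) (fun _ => d) 0

/-- The depths of the laminar flows with Bernoulli constant `r`. -/
def laminarDepths (r : ℝ) : Set ℝ := {d | 0 < d ∧ 1 / (2 * d ^ 2) + d = r}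

/-- The supercritical depth: the smaller of the two laminar depths. -/
def depthMinus (r : ℝ) : ℝ := sInf (laminarDepths r)

/-- The subcritical depth: the larger of the two laminar depths. -/
def depthPlus (r : ℝ) : ℝ := sSup (laminarDepths r)

/-- The flow force of the supercritical laminar flow. -/
def flowForceMinus (r : ℝ) : ℝ := laminarFlowForce r (depthMinus r)

/-- The flow force of the subcritical laminar flow. -/
def flowForcePlus (r : ℝ) : ℝ := laminarFlowForce r (depthPlus r)

/-- The Froude number of a uniform stream of depth `d`. -/
def froude (d : ℝ) : ℝ := d ^ (-(3 / 2) : ℝ)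

end SteadyWave

end

/-! Write `u = ψ_y` and `v = ψ_x`. Then `u + iv` is holomorphic, so `H(x,y) = ∫₀^y (u² - v²)`
(`verticalFlux`), an imaginary part of a primitive of `(u + iv)²`, is harmonic; it vanishes on the
bed. Bernoulli's law and the kinematic condition give `H = c + (r - η)²` on the surface for a
constant `c`. The flow force is then `(c + r²)/2`, and the lower bound says exactly that `c > 0`.

Let `h` be the supremum of `η`. Comparing `ψ` with linear functions of `y` gives `2(r - h) ≤ 1/h²`
at the crest and the reverse inequality at the trough level. Since `1/s² + 2s` is strictly
decreasing on `(0, 1]`, a non-laminar wave has `h ≥ 1`, hence `r < 3h`. Now suppose `c ≤ 0` and put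
`m = c + (r - h)²`. The maximum principle puts `H` above `m` if `m ≤ 0` and above `(m/h)y` if `m >
0`. Comparing vertical derivatives at the crest gives `2(r - h) ≤ 0`, or `2(r - h) ≤ (r - h)²/h`,
that is `r ≥ 3h`; both are impossible because `h < r`. Crest and trough levels need not be attained,
so the maximum principle is proved in unbounded strips, the Hopf lemma is made uniform, and
derivatives are compared along extremizing sequences.

For a solitary wave, the far-field limit of the surface identity and of Bernoulli's law gives `c +
(r - d)² ≤ 1/d` and `1/d² ≤ 2(r - d)`. With `c > 0` this yields `4d³ > 1`, which is `F < 2`. The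
laminar claims follow from the fact that the flow force minus `r²/2` equals `(4d³ - 1)/(8d⁴)`. -/

/-! ### Pointwise Laplacians and the maximum principle. -/

/-- `f` is differentiable near `x` and its derivative has derivative `a` at `x`. -/
def HasSecondDerivAt (f : ℝ → ℝ) (a x : ℝ) : Prop :=
  ∃ f' : ℝ → ℝ, (∀ᶠ y in 𝓝 x, HasDerivAt f (f' y) y) ∧ HasDerivAt f' a x

/-- The second partial derivatives of `w` exist at `p` and add up to `L`. -/
def HasLaplacianAt (w : ℝ × ℝ → ℝ) (L : ℝ) (p : ℝ × ℝ) : Prop :=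
  ∃ a b : ℝ, HasSecondDerivAt (fun s => w (s, p.2)) a p.1 ∧
    HasSecondDerivAt (fun s => w (p.1, s)) b p.2 ∧ a + b = L

/-- If `a > 0`, the point would also be a local minimum, so `f` would be locally constant and `a =
0`. -/
theorem HasSecondDerivAt.nonpos_of_isLocalMax {f : ℝ → ℝ} {a x : ℝ}
    (h : HasSecondDerivAt f a x) (hm : IsLocalMax f x) : a ≤ 0 := by
  obtain ⟨f', h1, h2⟩ := h
  by_contra! ha
  have e1 : deriv f =ᶠ[𝓝 x] f' := h1.mono fun y hy => hy.deriv
  have e2 : deriv (deriv f) x = a := by rw [e1.deriv_eq, h2.deriv]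
  have hmin := isLocalMin_of_deriv_deriv_pos (by rw [e2]; exact ha) hm.deriv_eq_zero
    h1.self_of_nhds.continuousAt
  have hc : f =ᶠ[𝓝 x] fun _ => f x := by
    filter_upwards [hm, hmin] with y h3 h4 using le_antisymm h3 h4
  have hd : deriv f =ᶠ[𝓝 x] fun _ => (0 : ℝ) := by
    filter_upwards [hc.deriv] with y hy
    simpa using hy
  have : deriv (deriv f) x = 0 := by rw [hd.deriv_eq]; simp
  linarith

theorem HasSecondDerivAt.add {f g : ℝ → ℝ} {a b x : ℝ} (hf : HasSecondDerivAt f a x)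
    (hg : HasSecondDerivAt g b x) : HasSecondDerivAt (fun y => f y + g y) (a + b) x := by
  obtain ⟨f', h1, h2⟩ := hf
  obtain ⟨g', h3, h4⟩ := hg
  refine ⟨fun y => f' y + g' y, ?_, h2.add h4⟩
  filter_upwards [h1, h3] with y hy hy' using hy.add hy'

theorem HasSecondDerivAt.const_mul {f : ℝ → ℝ} {a x : ℝ} (c : ℝ) (hf : HasSecondDerivAt f a x) :
    HasSecondDerivAt (fun y => c * f y) (c * a) x := by
  obtain ⟨f', h1, h2⟩ := hf
  refine ⟨fun y => c * f' y, ?_, h2.const_mul c⟩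
  filter_upwards [h1] with y hy using hy.const_mul c

theorem HasLaplacianAt.add {f g : ℝ × ℝ → ℝ} {a b : ℝ} {p : ℝ × ℝ} (hf : HasLaplacianAt f a p)
    (hg : HasLaplacianAt g b p) : HasLaplacianAt (fun y => f y + g y) (a + b) p := by
  obtain ⟨a1, a2, h1, h2, rfl⟩ := hf
  obtain ⟨b1, b2, h3, h4, rfl⟩ := hg
  exact ⟨a1 + b1, a2 + b2, h1.add h3, h2.add h4, by ring⟩

theorem HasLaplacianAt.const_mul {f : ℝ × ℝ → ℝ} {a : ℝ} {p : ℝ × ℝ} (c : ℝ)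
    (hf : HasLaplacianAt f a p) : HasLaplacianAt (fun y => c * f y) (c * a) p := by
  obtain ⟨a1, a2, h1, h2, rfl⟩ := hf
  exact ⟨c * a1, c * a2, h1.const_mul c, h2.const_mul c, by ring⟩

theorem hasSecondDerivAt_quadratic (a b c x : ℝ) :
    HasSecondDerivAt (fun s => a * s ^ 2 + b * s + c) (2 * a) x := by
  refine ⟨fun s => 2 * a * s + b, Eventually.of_forall fun y => ?_, ?_⟩
  · have := (((hasDerivAt_id y).pow 2).const_mul a).add ((hasDerivAt_id y).const_mul b)
      |>.add_const c
    refine this.congr_deriv ?_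
    simp; ring
  · have := ((hasDerivAt_id x).const_mul (2 * a)).add_const b
    simpa using this

theorem hasLaplacianAt_quadratic (a b c d e : ℝ) (p : ℝ × ℝ) :
    HasLaplacianAt (fun p => a * p.1 ^ 2 + b * p.1 + c * p.2 ^ 2 + d * p.2 + e)
      (2 * a + 2 * c) p := by
  refine ⟨2 * a, 2 * c, ?_, ?_, rfl⟩
  · convert hasSecondDerivAt_quadratic a b (c * p.2 ^ 2 + d * p.2 + e) p.1 using 2
    ring
  · convert hasSecondDerivAt_quadratic c d (a * p.1 ^ 2 + b * p.1 + e) p.2 using 2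
    ring

/-- A maximum principle in unbounded horizontal strips. -/
theorem nonpos_of_laplacian_nonneg {D U : Set (ℝ × ℝ)} {w : ℝ × ℝ → ℝ} {R A : ℝ}
    (hD : IsClosed D) (hU : IsOpen U) (hUD : U ⊆ D) (hstrip : ∀ p ∈ D, |p.2| ≤ R)
    (hw : ContinuousOn w D) (hA : ∀ p ∈ D, w p ≤ A) (hb : ∀ p ∈ D, p ∉ U → w p ≤ 0)
    (hL : ∀ p ∈ U, ∃ L, 0 ≤ L ∧ HasLaplacianAt w L p) : ∀ p ∈ D, w p ≤ 0 := by
  intro p₀ hp₀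
  have hBpos : ∀ p ∈ D, 0 ≤ 2 * R ^ 2 - 2 * p.2 ^ 2 := fun p hp => by
    have := sq_le_sq' (abs_le.1 (hstrip p hp)).1 (abs_le.1 (hstrip p hp)).2
    linarith
  -- `B = x² - 2y² + 2R²` is nonnegative on the strip, grows as `|x| → ∞`, and has Laplacian `-2`.
  -- Thus `w - εB` attains any positive maximum and is strictly subharmonic in `U`.
  set B : ℝ × ℝ → ℝ := fun p => 1 * p.1 ^ 2 + 0 * p.1 + (-2) * p.2 ^ 2 + 0 * p.2 + 2 * R ^ 2
    with hB
  have key : ∀ ε > 0, w p₀ ≤ ε * B p₀ := by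
    intro ε hε
    by_contra! hcon
    set W : ℝ × ℝ → ℝ := fun p => w p + (-ε) * B p with hW
    have hWc : ContinuousOn W D := by
      refine hw.add (Continuous.continuousOn ?_)
      rw [hB]; fun_prop
    -- Chosen so that `εX² ≥ εX ≥ |A|`: beyond `|x| = X` the penalty outweighs the upper bound `A`.
    set X : ℝ := 1 + |A| / ε with hX
    have hXpos : 1 ≤ X := by rw [hX]; have : 0 ≤ |A| / ε := by positivity
                             linarith
    have hfar : ∀ p ∈ D, X < |p.1| → W p ≤ 0 := by
      intro p hp hx
      have h1 : X ≤ p.1 ^ 2 := by rw [← sq_abs]; nlinarith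
      have h2 : ε * X ≤ ε * B p := by
        refine mul_le_mul_of_nonneg_left ?_ hε.le
        have := hBpos p hp
        simp only [hB]; linarith
      have h3 : |A| ≤ ε * X := by
        rw [hX, mul_add, mul_div_cancel₀ _ hε.ne']; linarith
      have := hA p hp
      simp only [hW]
      linarith [le_abs_self A]
    set K : Set (ℝ × ℝ) := D ∩ (Icc (-X) X ×ˢ Icc (-R) R) with hK
    have hKc : IsCompact K := (isCompact_Icc.prod isCompact_Icc).inter_left hD
    have hW0 : 0 < W p₀ := by simp only [hW]; linarith
    have hp₀K : p₀ ∈ K := by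
      refine ⟨hp₀, ?_, abs_le.1 (hstrip p₀ hp₀)⟩
      by_contra hx
      have : X < |p₀.1| := by
        by_contra! h; exact hx (abs_le.1 h)
      linarith [hfar p₀ hp₀ this]
    obtain ⟨q, hqK, hq⟩ := hKc.exists_isMaxOn ⟨p₀, hp₀K⟩ (hWc.mono inter_subset_left)
    have hWq : 0 < W q := hW0.trans_le (hq hp₀K)
    have hmax : ∀ p ∈ D, W p ≤ W q := by
      intro p hp
      by_cases hx : X < |p.1|
      · exact (hfar p hp hx).trans hWq.le
      · exact hq ⟨hp, abs_le.1 (not_lt.1 hx), abs_le.1 (hstrip p hp)⟩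
    have hqU : q ∈ U := by
      by_contra hqU
      have h1 := hb q hqK.1 hqU
      have h2 := hBpos q hqK.1
      have : 0 ≤ ε * B q := mul_nonneg hε.le (by simp only [hB]; nlinarith [sq_nonneg q.1])
      simp only [hW] at hWq
      linarith
    obtain ⟨L, hL0, hLap⟩ := hL q hqU
    obtain ⟨a, b, ha, hb', hab⟩ :=
      hLap.add ((hasLaplacianAt_quadratic 1 0 (-2) 0 (2 * R ^ 2) q).const_mul (-ε))
    have hUq : ∀ᶠ p in 𝓝 q, W p ≤ W q := by
      filter_upwards [hU.mem_nhds hqU] with p hp using hmax p (hUD hp)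
    have hloc1 : IsLocalMax (fun s => W (s, q.2)) q.1 := by
      have : Tendsto (fun s : ℝ => (s, q.2)) (𝓝 q.1) (𝓝 q) := by
        have : Continuous (fun s : ℝ => (s, q.2)) := by fun_prop
        exact this.tendsto q.1
      exact this.eventually hUq
    have hloc2 : IsLocalMax (fun s => W (q.1, s)) q.2 := by
      have : Tendsto (fun s : ℝ => (q.1, s)) (𝓝 q.2) (𝓝 q) := by
        have : Continuous (fun s : ℝ => (q.1, s)) := by fun_prop
        exact this.tendsto q.2
      exact this.eventually hUq
    have h1 := ha.nonpos_of_isLocalMax hloc1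
    have h2 := hb'.nonpos_of_isLocalMax hloc2
    linarith
  by_contra! hpos
  have hB0 : 0 ≤ B p₀ := by
    have := hBpos p₀ hp₀
    simp only [hB]; nlinarith [sq_nonneg p₀.1]
  have := key (w p₀ / (2 * (B p₀ + 1))) (by positivity)
  rw [div_mul_eq_mul_div, le_div_iff₀ (by positivity)] at this
  nlinarith

/-! ### One-variable estimates. -/

/-- A first order Taylor estimate for functions with Lipschitz derivative. -/
theorem abs_sub_sub_le_of_lipschitz_deriv {f f' : ℝ → ℝ} {K l h : ℝ}
    (hf : ContinuousOn f (Icc l h)) (hd : ∀ y ∈ Ioo l h, HasDerivAt f (f' y) y)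
    (hK : ∀ y ∈ Icc l h, ∀ z ∈ Icc l h, |f' y - f' z| ≤ K * |y - z|)
    {a b : ℝ} (ha : a ∈ Icc l h) (hb : b ∈ Icc l h) :
    |f b - f a - f' a * (b - a)| ≤ K * (b - a) ^ 2 := by
  rcases lt_trichotomy a b with hab | rfl | hab
  · obtain ⟨c, hc, hce⟩ := exists_hasDerivAt_eq_slope f f' hab
      (hf.mono (Icc_subset_Icc ha.1 hb.2))
      (fun x hx => hd x ⟨ha.1.trans_lt hx.1, hx.2.trans_le hb.2⟩)
    rw [eq_div_iff (by linarith)] at hce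
    have h1 := hK c ⟨ha.1.trans hc.1.le, hc.2.le.trans hb.2⟩ a ha
    have hK0 : 0 ≤ K := by
      by_contra! hK0
      have : 0 < |c - a| := abs_pos.2 (by linarith [hc.1])
      nlinarith [abs_nonneg (f' c - f' a)]
    rw [← hce, ← sub_mul, abs_mul, abs_of_pos (sub_pos.2 hab)]
    have h2 : |c - a| ≤ b - a := by rw [abs_of_pos (by linarith [hc.1])]; linarith [hc.2]
    nlinarith [mul_le_mul_of_nonneg_left h2 hK0]
  · simp
  · obtain ⟨c, hc, hce⟩ := exists_hasDerivAt_eq_slope f f' hab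
      (hf.mono (Icc_subset_Icc hb.1 ha.2))
      (fun x hx => hd x ⟨hb.1.trans_lt hx.1, hx.2.trans_le ha.2⟩)
    rw [eq_div_iff (by linarith)] at hce
    have h1 := hK c ⟨hb.1.trans hc.1.le, hc.2.le.trans ha.2⟩ a ha
    have hK0 : 0 ≤ K := by
      by_contra! hK0
      have : 0 < |c - a| := abs_pos.2 (by linarith [hc.2])
      nlinarith [abs_nonneg (f' c - f' a)]
    have : f b - f a - f' a * (b - a) = -((f' c - f' a) * (a - b)) := by
      linear_combination hce
    rw [this, abs_neg, abs_mul, abs_of_pos (sub_pos.2 hab)]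
    have h2 : |c - a| ≤ a - b := by rw [abs_of_neg (by linarith [hc.2])]; linarith [hc.1]
    nlinarith [mul_le_mul_of_nonneg_left h2 hK0]

/-- Applied after dividing an inequality at depth `t` below the surface by `t`; it compares boundary
derivatives without differentiating across the boundary. -/
theorem le_of_forall_small_le_add_mul {a b K t₀ : ℝ} (ht₀ : 0 < t₀)
    (h : ∀ t, 0 < t → t ≤ t₀ → a ≤ b + K * t) : a ≤ b := by
  have h1 : Tendsto (fun t : ℝ => b + K * t) (𝓝[>] 0) (𝓝 b) := by
    have : Continuous (fun t : ℝ => b + K * t) := by fun_prop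
    simpa using (this.tendsto 0).mono_left nhdsWithin_le_nhds
  refine ge_of_tendsto h1 ?_
  filter_upwards [Ioc_mem_nhdsGT ht₀] with t ht using h t ht.1 ht.2

open SteadyWave

/-! ### From the regularity class to velocity components. -/

/-- A steady wave in terms of its velocity components `u = ψ_y` and `v = ψ_x`, together with a
common bound `C` for all the quantities that the regularity class controls. -/
structure IsWave (r C : ℝ) (ψ u v : ℝ × ℝ → ℝ) (η η' : ℝ → ℝ) : Prop where
  bound_pos : 0 < C
  depth_pos : ∀ x, 0 < η x
  psi_cont : ContinuousOn ψ (closedFluid η)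
  u_cont : ContinuousOn u (closedFluid η)
  v_cont : ContinuousOn v (closedFluid η)
  psi_bound : ∀ p ∈ closedFluid η, |ψ p| ≤ C
  u_bound : ∀ p ∈ closedFluid η, |u p| ≤ C
  v_bound : ∀ p ∈ closedFluid η, |v p| ≤ C
  u_lipschitz : ∀ x, ∀ y ∈ Icc 0 (η x), ∀ z ∈ Icc 0 (η x), |u (x, y) - u (x, z)| ≤ C * |y - z|
  v_lipschitz : ∀ x, ∀ y ∈ Icc 0 (η x), ∀ z ∈ Icc 0 (η x), |v (x, y) - v (x, z)| ≤ C * |y - z|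
  psi_fderiv : ∀ p ∈ fluid η, ∃ L : ℝ × ℝ →L[ℝ] ℝ, HasFDerivAt ψ L p ∧ L (1, 0) = v p ∧
    L (0, 1) = u p
  velocity_fderiv : ∀ p ∈ fluid η, ∃ A B : ℝ × ℝ →L[ℝ] ℝ, HasFDerivAt u A p ∧ HasFDerivAt v B p ∧
    A (1, 0) = B (0, 1) ∧ A (0, 1) = -B (1, 0) ∧ ‖A‖ ≤ C ∧ ‖B‖ ≤ C
  surface_deriv : ∀ x, HasDerivAt η (η' x) x
  slope_bound : ∀ x, |η' x| ≤ C
  slope_lipschitz : ∀ x z, |η' x - η' z| ≤ C * |x - z|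
  bernoulli : ∀ x, u (x, η x) ^ 2 + v (x, η x) ^ 2 = 2 * (r - η x)
  bottom : ∀ x, ψ (x, 0) = 0
  top : ∀ x, ψ (x, η x) = 1
  v_bottom : ∀ x, v (x, 0) = 0
  v_top : ∀ x, v (x, η x) = -u (x, η x) * η' x

theorem closedFluid_eq_image {η : ℝ → ℝ} (hη : ∀ x, 0 < η x) :
    closedFluid η = (fun p : ℝ × ℝ => (p.1, p.2 * η p.1)) '' (univ ×ˢ Icc 0 1) := by
  ext ⟨x, y⟩
  simp only [closedFluid, mem_ofPred_eq, mem_image, mem_prod, mem_univ, true_and, mem_Icc,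
    Prod.exists, Prod.mk.injEq]
  constructor
  · rintro ⟨h1, h2⟩
    exact ⟨x, y / η x, ⟨div_nonneg h1 (hη x).le, (div_le_one (hη x)).2 h2⟩, rfl,
      div_mul_cancel₀ _ (hη x).ne'⟩
  · rintro ⟨a, b, ⟨h1, h2⟩, rfl, rfl⟩
    exact ⟨mul_nonneg h1 (hη a).le, by nlinarith [hη a]⟩

/-- The domain is the image of a flat strip under `(x, t) ↦ (x, tη(x))`, whose derivative is
surjective because `η > 0`. -/
theorem uniqueDiffOn_closedFluid {η η' : ℝ → ℝ} (hη : ∀ x, 0 < η x)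
    (hd : ∀ x, HasDerivAt η (η' x) x) : UniqueDiffOn ℝ (closedFluid η) := by
  rw [closedFluid_eq_image hη]
  have hf : ∀ p : ℝ × ℝ, HasFDerivAt (fun p : ℝ × ℝ => (p.1, p.2 * η p.1))
      ((ContinuousLinearMap.fst ℝ ℝ ℝ).prod (p.2 • (η' p.1 • ContinuousLinearMap.fst ℝ ℝ ℝ) +
        η p.1 • ContinuousLinearMap.snd ℝ ℝ ℝ)) p := by
    intro p
    refine HasFDerivAt.prodMk hasFDerivAt_fst ?_
    exact hasFDerivAt_snd.mul ((hd p.1).comp_hasFDerivAt p hasFDerivAt_fst)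
  refine UniqueDiffOn.image (uniqueDiffOn_univ.prod (uniqueDiffOn_Icc one_pos))
    (fun p _ => (hf p).hasFDerivWithinAt) fun p _ => Function.Surjective.denseRange ?_
  rintro ⟨a, b⟩
  refine ⟨(a, (b - p.2 * (η' p.1 * a)) / η p.1), ?_⟩
  simp only [ContinuousLinearMap.prod_apply, ContinuousLinearMap.coe_fst',
    add_apply, smul_apply, ContinuousLinearMap.coe_snd',
    smul_eq_mul, Prod.mk.injEq, true_and]
  field_simp [(hη p.1).ne']
  ring

theorem isClosed_closedFluid {η : ℝ → ℝ} (hη : Continuous η) : IsClosed (closedFluid η) :=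
  (isClosed_le continuous_const continuous_snd).inter
    (isClosed_le continuous_snd (hη.comp continuous_fst))

theorem isOpen_fluid {η : ℝ → ℝ} (hη : Continuous η) : IsOpen (fluid η) :=
  (isOpen_lt continuous_const continuous_snd).inter
    (isOpen_lt continuous_snd (hη.comp continuous_fst))

theorem fluid_subset (η : ℝ → ℝ) : fluid η ⊆ closedFluid η := fun _ hp => ⟨hp.1.le, hp.2.le⟩

theorem SteadyWave.MemC2Holder.surface {γ : ℝ≥0} {η : ℝ → ℝ} (h : MemC2Holder γ univ η) :
    ∃ C : ℝ, 0 < C ∧ (∀ x, HasDerivAt η (deriv η x) x) ∧ (∀ x, |deriv η x| ≤ C) ∧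
      ∀ x z, |deriv η x - deriv η z| ≤ C * |x - z| := by
  obtain ⟨hc, C, hC, -⟩ := h
  rw [contDiffOn_univ] at hc
  have hC' : ∀ k ≤ 2, ∀ x, |iteratedDeriv k η x| ≤ C := by
    intro k hk x
    have := hC k hk x (mem_univ x)
    rwa [iteratedFDerivWithin_univ, norm_iteratedFDeriv_eq_norm_iteratedDeriv] at this
  have hd1 : Differentiable ℝ η := hc.differentiable (by norm_num)
  have hd2 : Differentiable ℝ (deriv η) := by
    have : ContDiff ℝ 1 (deriv η) := ContDiff.deriv' (by simpa [one_add_one_eq_two] using hc)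
    exact this.differentiable (by norm_num)
  refine ⟨C + 1, by positivity, fun x => (hd1 x).hasDerivAt, fun x => ?_, fun x z => ?_⟩
  · have := hC' 1 (by norm_num) x
    rw [iteratedDeriv_one] at this
    linarith
  · have := Convex.norm_image_sub_le_of_norm_hasDerivWithin_le (f := deriv η)
      (f' := deriv (deriv η)) (s := univ) (C := (C : ℝ)) (x := z) (y := x)
      (fun y _ => (hd2 y).hasDerivAt.hasDerivWithinAt)
      (fun y _ => by
        have := hC' 2 le_rfl y
        rwa [iteratedDeriv_succ, iteratedDeriv_one] at this) convex_univ trivial trivial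
    simp only [Real.norm_eq_abs] at this
    nlinarith [abs_nonneg (x - z)]

theorem SteadyWave.IsSolution.exists_isWave {γ : ℝ≥0} {r : ℝ} {ψ : ℝ × ℝ → ℝ} {η : ℝ → ℝ}
    (hψ : MemC2Holder γ (closedFluid η) ψ) (hη : MemC2Holder γ univ η)
    (h : IsSolution r ψ η) :
    ∃ C, IsWave r C ψ (partialY (closedFluid η) ψ) (partialX (closedFluid η) ψ) η (deriv η) := by
  obtain ⟨C₁, hC₁, hd, hb, hl⟩ := hη.surface
  obtain ⟨hc, C₀, hC₀, -⟩ := hψ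
  set S := closedFluid η with hS
  have hηc : Continuous η := continuous_iff_continuousAt.2 fun x => (hd x).continuousAt
  have hU : UniqueDiffOn ℝ S := uniqueDiffOn_closedFluid h.depth_pos hd
  set D := fderivWithin ℝ ψ S with hD
  have hDc : ContDiffOn ℝ 1 D S := hc.fderivWithin hU (by norm_num)
  set D2 := fderivWithin ℝ D S with hD2
  have hψD : ∀ p ∈ S, HasFDerivWithinAt ψ (D p) S p := fun p hp =>
    ((hc.differentiableOn (by norm_num)) p hp).hasFDerivWithinAt
  have hDD2 : ∀ p ∈ S, HasFDerivWithinAt D (D2 p) S p := fun p hp =>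
    ((hDc.differentiableOn (by norm_num)) p hp).hasFDerivWithinAt
  have b0 : ∀ p ∈ S, |ψ p| ≤ C₀ := fun p hp => by
    have := hC₀ 0 (by norm_num) p hp
    rwa [norm_iteratedFDerivWithin_zero] at this
  have b1 : ∀ p ∈ S, ‖D p‖ ≤ C₀ := fun p hp => by
    have := hC₀ 1 (by norm_num) p hp
    rwa [norm_iteratedFDerivWithin_one _ (hU p hp)] at this
  have b2 : ∀ p ∈ S, ‖D2 p‖ ≤ C₀ := fun p hp => by
    have := hC₀ 2 (by norm_num) p hp
    rwa [← norm_iteratedFDerivWithin_fderivWithin hU hp,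
      norm_iteratedFDerivWithin_one _ (hU p hp)] at this
  have hn1 : ‖((1, 0) : ℝ × ℝ)‖ = 1 := by simp [Prod.norm_def]
  have hn2 : ‖((0, 1) : ℝ × ℝ)‖ = 1 := by simp [Prod.norm_def]
  have bev : ∀ e : ℝ × ℝ, ‖e‖ = 1 → ∀ T : ℝ × ℝ →L[ℝ] ℝ, |T e| ≤ ‖T‖ := fun e he T => by
    have := T.le_opNorm e
    rwa [he, mul_one, Real.norm_eq_abs] at this
  -- The domain need not be convex, but its vertical segments are, and only vertical Lipschitz
  -- bounds are used.
  have hDlip : ∀ x, ∀ y ∈ Icc 0 (η x), ∀ z ∈ Icc 0 (η x),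
      ‖D (x, y) - D (x, z)‖ ≤ C₀ * |y - z| := by
    intro x y hy z hz
    refine Convex.norm_image_sub_le_of_norm_hasDerivWithin_le (f := fun t => D (x, t))
      (f' := fun t => D2 (x, t) (0, 1)) (s := Icc 0 (η x)) ?_ ?_ (convex_Icc _ _) hz hy
    · intro t ht
      have hg : HasDerivWithinAt (fun t : ℝ => (x, t)) ((0, 1) : ℝ × ℝ) (Icc 0 (η x)) t :=
        (hasDerivAt_const t x).prodMk (hasDerivAt_id t) |>.hasDerivWithinAt
      exact (hDD2 (x, t) ht).comp_hasDerivWithinAt t hg fun s hs => hs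
    · intro t ht
      have := (D2 (x, t)).le_opNorm (0, 1)
      rw [hn2, mul_one] at this
      exact this.trans (b2 (x, t) ht)
  have hev : ∀ (e p : ℝ × ℝ) (s : Set (ℝ × ℝ)), HasFDerivWithinAt D (D2 p) s p →
      HasFDerivWithinAt (fun q => D q e) ((D2 p).flip e) s p := fun e p s hs =>
    (ContinuousLinearMap.apply ℝ ℝ e).hasFDerivAt.comp_hasFDerivWithinAt p hs
  have hint : ∀ p ∈ fluid η, S ∈ 𝓝 p := fun p hp =>
    mem_of_superset ((isOpen_fluid hηc).mem_nhds hp) (fluid_subset η)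
  have hflip : ∀ e : ℝ × ℝ, ‖e‖ = 1 → ∀ p ∈ S, ‖(D2 p).flip e‖ ≤ C₀ := fun e he p hp => by
    have := (D2 p).flip.le_opNorm e
    rw [he, mul_one, ContinuousLinearMap.opNorm_flip] at this
    exact this.trans (b2 p hp)
  refine ⟨C₀ + C₁, ?_⟩
  have hle : (C₀ : ℝ) ≤ C₀ + C₁ := by linarith
  have hle' : C₁ ≤ C₀ + C₁ := by linarith [C₀.coe_nonneg]
  refine
    { bound_pos := by positivity
      depth_pos := h.depth_pos
      psi_cont := hc.continuousOn
      u_cont := hDc.continuousOn.clm_apply continuousOn_const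
      v_cont := hDc.continuousOn.clm_apply continuousOn_const
      psi_bound := fun p hp => (b0 p hp).trans hle
      u_bound := fun p hp => ((bev _ hn2 _).trans (b1 p hp)).trans hle
      v_bound := fun p hp => ((bev _ hn1 _).trans (b1 p hp)).trans hle
      u_lipschitz := fun x y hy z hz => (bev _ hn2 _).trans
        ((hDlip x y hy z hz).trans (mul_le_mul_of_nonneg_right hle (abs_nonneg _)))
      v_lipschitz := fun x y hy z hz => (bev _ hn1 _).trans
        ((hDlip x y hy z hz).trans (mul_le_mul_of_nonneg_right hle (abs_nonneg _)))
      psi_fderiv := fun p hp =>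
        ⟨D p, (hψD p (fluid_subset η hp)).hasFDerivAt (hint p hp), rfl, rfl⟩
      velocity_fderiv := ?_
      surface_deriv := hd
      slope_bound := fun x => (hb x).trans hle'
      slope_lipschitz := fun x z =>
        (hl x z).trans (mul_le_mul_of_nonneg_right hle' (abs_nonneg _))
      bernoulli := fun x => by linarith [h.bernoulli x]
      bottom := h.bottom
      top := h.top
      v_bottom := ?_
      v_top := ?_ }
  · intro p hp
    have hpS := fluid_subset η hp
    refine ⟨(D2 p).flip (0, 1), (D2 p).flip (1, 0),
      (hev _ p S (hDD2 p hpS)).hasFDerivAt (hint p hp),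
      (hev _ p S (hDD2 p hpS)).hasFDerivAt (hint p hp), ?_, ?_,
      (hflip _ hn2 p hpS).trans hle, (hflip _ hn1 p hpS).trans hle⟩
    · refine second_derivative_symmetric_of_eventually (f := ψ) (f' := D) (x := p) ?_
        ((hDD2 p hpS).hasFDerivAt (hint p hp)) (1, 0) (0, 1)
      filter_upwards [(isOpen_fluid hηc).mem_nhds hp] with q hq
      exact (hψD q (fluid_subset η hq)).hasFDerivAt (hint q hq)
    · have := h.laplace p hp
      have e1 : partialX S (partialX S ψ) p = (D2 p).flip (1, 0) (1, 0) := by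
        rw [partialX]
        exact congrArg (fun T : ℝ × ℝ →L[ℝ] ℝ => T (1, 0))
          ((hev (1, 0) p S (hDD2 p hpS)).fderivWithin (hU p hpS))
      have e2 : partialY S (partialY S ψ) p = (D2 p).flip (0, 1) (0, 1) := by
        rw [partialY]
        exact congrArg (fun T : ℝ × ℝ →L[ℝ] ℝ => T (0, 1))
          ((hev (0, 1) p S (hDD2 p hpS)).fderivWithin (hU p hpS))
      rw [← e1, ← e2]
      linarith
  -- The tangential derivative of `ψ = 0` along the bed.
  · intro x
    have hmem : ∀ t : ℝ, (t, (0 : ℝ)) ∈ S := fun t => ⟨le_rfl, (h.depth_pos t).le⟩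
    have hg : HasDerivWithinAt (fun t : ℝ => (t, (0 : ℝ))) ((1, 0) : ℝ × ℝ) univ x :=
      (hasDerivAt_id x).prodMk (hasDerivAt_const x 0) |>.hasDerivWithinAt
    have h1 := (hψD (x, 0) (hmem x)).comp_hasDerivWithinAt x hg fun t _ => hmem t
    have h2 : ψ ∘ (fun t : ℝ => (t, (0 : ℝ))) = fun _ => 0 := funext fun t => h.bottom t
    rw [h2, hasDerivWithinAt_univ] at h1
    exact h1.unique (hasDerivAt_const x 0)
  -- The tangential derivative of `ψ = 1` along the surface is the kinematic condition.
  · intro x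
    have hmem : ∀ t : ℝ, (t, η t) ∈ S := fun t => ⟨(h.depth_pos t).le, le_rfl⟩
    have hg : HasDerivWithinAt (fun t : ℝ => (t, η t)) ((1, deriv η x) : ℝ × ℝ) univ x :=
      (hasDerivAt_id x).prodMk (hd x) |>.hasDerivWithinAt
    have h1 := (hψD (x, η x) (hmem x)).comp_hasDerivWithinAt x hg fun t _ => hmem t
    have h2 : ψ ∘ (fun t : ℝ => (t, η t)) = fun _ => 1 := funext fun t => h.top t
    rw [h2, hasDerivWithinAt_univ] at h1
    have h3 := h1.unique (hasDerivAt_const x 1)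
    have h4 : ((1, deriv η x) : ℝ × ℝ) = (1, 0) + deriv η x • (0, 1) := by ext <;> simp
    rw [h4, map_add, map_smul, smul_eq_mul] at h3
    change D (x, η x) (1, 0) = -D (x, η x) (0, 1) * deriv η x
    linarith

/-! ### The harmonic flux function and the flow force. -/

/-- The integral of `u² - v²` over the vertical segment below `p`. -/
noncomputable def verticalFlux (u v : ℝ × ℝ → ℝ) (p : ℝ × ℝ) : ℝ :=
  ∫ y in (0 : ℝ)..p.2, (u (p.1, y) ^ 2 - v (p.1, y) ^ 2)

theorem verticalFlux_bottom (u v : ℝ × ℝ → ℝ) (x : ℝ) : verticalFlux u v (x, 0) = 0 := by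
  simp [verticalFlux]

/-- The fixed interval of integration allows differentiation under the integral sign even when the
upper end moves with `x`. -/
theorem verticalFlux_eq_integral_unit (u v : ℝ × ℝ → ℝ) (x y : ℝ) :
    verticalFlux u v (x, y) =
      ∫ t in (0 : ℝ)..1, y * (u (x, t * y) ^ 2 - v (x, t * y) ^ 2) := by
  rw [intervalIntegral.integral_const_mul,
    intervalIntegral.mul_integral_comp_mul_right (f := fun y => u (x, y) ^ 2 - v (x, y) ^ 2)]
  simp [verticalFlux]

namespace IsWave

variable {r C : ℝ} {ψ u v : ℝ × ℝ → ℝ} {η η' : ℝ → ℝ}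

theorem continuous_surface (W : IsWave r C ψ u v η η') : Continuous η :=
  continuous_iff_continuousAt.2 fun x => (W.surface_deriv x).continuousAt

theorem surface_le (W : IsWave r C ψ u v η η') (x : ℝ) : η x ≤ r := by
  nlinarith [W.bernoulli x, sq_nonneg (u (x, η x)), sq_nonneg (v (x, η x))]

theorem fluid_mem_nhds (W : IsWave r C ψ u v η η') {p : ℝ × ℝ} (hp : p ∈ fluid η) :
    fluid η ∈ 𝓝 p :=
  (isOpen_fluid W.continuous_surface).mem_nhds hp

theorem flux_density_cont (W : IsWave r C ψ u v η η') :
    ContinuousOn (fun p => u p ^ 2 - v p ^ 2) (closedFluid η) :=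
  (W.u_cont.pow 2).sub (W.v_cont.pow 2)

theorem flux_density_bound (W : IsWave r C ψ u v η η') {p : ℝ × ℝ} (hp : p ∈ closedFluid η) :
    |u p ^ 2 - v p ^ 2| ≤ C ^ 2 := by
  have h1 := sq_le_sq' (abs_le.1 (W.u_bound p hp)).1 (abs_le.1 (W.u_bound p hp)).2
  have h2 := sq_le_sq' (abs_le.1 (W.v_bound p hp)).1 (abs_le.1 (W.v_bound p hp)).2
  rw [abs_le]
  constructor <;> nlinarith [sq_nonneg (u p), sq_nonneg (v p)]

theorem vertical_continuousOn {f : ℝ × ℝ → ℝ} (hf : ContinuousOn f (closedFluid η)) (x : ℝ) :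
    ContinuousOn (fun y => f (x, y)) (Icc 0 (η x)) :=
  hf.comp (by fun_prop) fun _ hy => hy

theorem scaled_continuousOn {f : ℝ × ℝ → ℝ} (hf : ContinuousOn f (closedFluid η)) {x y : ℝ}
    (hy : (x, y) ∈ closedFluid η) : ContinuousOn (fun t => f (x, t * y)) (Icc 0 1) :=
  hf.comp (by fun_prop) fun t ht =>
    ⟨mul_nonneg ht.1 hy.1, (mul_le_of_le_one_left hy.1 ht.2).trans hy.2⟩

/-- The Cauchy–Riemann equations leave two independent partials, `a = u_x = v_y` and `b = u_y =
-v_x`. The chain rule is packaged for arbitrary curves. -/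
theorem velocity_partials (W : IsWave r C ψ u v η η') :
    ∃ a b : ℝ × ℝ → ℝ, ∀ p ∈ fluid η, |a p| ≤ C ∧ |b p| ≤ C ∧
      ∀ (k l : ℝ → ℝ) (k' l' s : ℝ), (k s, l s) = p → HasDerivAt k k' s → HasDerivAt l l' s →
        HasDerivAt (fun s => u (k s, l s)) (k' * a p + l' * b p) s ∧
        HasDerivAt (fun s => v (k s, l s)) (k' * (-b p) + l' * a p) s := by
  have hW := W.velocity_fderiv
  choose! A B hA hB h1 h2 h3 h4 using hW
  refine ⟨fun p => A p (1, 0), fun p => A p (0, 1), fun p hp => ⟨?_, ?_, ?_⟩⟩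
  · have := (A p).le_opNorm (1, 0)
    rw [Real.norm_eq_abs, show ‖((1, 0) : ℝ × ℝ)‖ = 1 by simp [Prod.norm_def], mul_one] at this
    exact this.trans (h3 p hp)
  · have := (A p).le_opNorm (0, 1)
    rw [Real.norm_eq_abs, show ‖((0, 1) : ℝ × ℝ)‖ = 1 by simp [Prod.norm_def], mul_one] at this
    exact this.trans (h3 p hp)
  · intro k l k' l' s hs hk hl
    have hdec : ((k', l') : ℝ × ℝ) = k' • (1, 0) + l' • (0, 1) := by ext <;> simp
    have hg : HasDerivAt (fun s => (k s, l s)) (k', l') s := hk.prodMk hl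
    have e1 := HasFDerivAt.comp_hasDerivAt (f := fun s => (k s, l s)) s
      (by rw [hs]; exact hA p hp) hg
    have e2 := HasFDerivAt.comp_hasDerivAt (f := fun s => (k s, l s)) s
      (by rw [hs]; exact hB p hp) hg
    rw [hdec, map_add, map_smul, map_smul, smul_eq_mul, smul_eq_mul] at e1 e2
    refine ⟨e1, e2.congr_deriv ?_⟩
    simp only [← h1 p hp, h2 p hp, neg_neg]

/-- The derivative of the flux below a curve that stays inside the fluid. -/
theorem hasDerivAt_verticalFlux_curve (W : IsWave r C ψ u v η η') {h h' : ℝ → ℝ} {x₀ M : ℝ}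
    (hh : ∀ᶠ x in 𝓝 x₀, HasDerivAt h (h' x) x ∧ 0 < h x ∧ h x ≤ η x ∧ |h' x| ≤ M) :
    HasDerivAt (fun x => verticalFlux u v (x, h x))
      (h' x₀ * (u (x₀, h x₀) ^ 2 - v (x₀, h x₀) ^ 2) + 2 * u (x₀, h x₀) * v (x₀, h x₀)) x₀ := by
  obtain ⟨a, b, hab⟩ := W.velocity_partials
  set s : Set ℝ := {x | HasDerivAt h (h' x) x ∧ 0 < h x ∧ h x ≤ η x ∧ |h' x| ≤ M} with hs
  have hsn : s ∈ 𝓝 x₀ := hh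
  have hx₀ : x₀ ∈ s := mem_of_mem_nhds hsn
  have hCS : ∀ x ∈ s, (x, h x) ∈ closedFluid η := fun x hx => ⟨hx.2.1.le, hx.2.2.1⟩
  have hin : ∀ x ∈ s, ∀ t ∈ Ioo (0 : ℝ) 1, (x, t * h x) ∈ fluid η := fun x hx t ht =>
    ⟨mul_pos ht.1 hx.2.1, (mul_lt_of_lt_one_left hx.2.1 ht.2).trans_le hx.2.2.1⟩
  set F : ℝ → ℝ → ℝ := fun x t => h x * (u (x, t * h x) ^ 2 - v (x, t * h x) ^ 2) with hF
  set F' : ℝ → ℝ → ℝ := fun x t => h' x * (u (x, t * h x) ^ 2 - v (x, t * h x) ^ 2) +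
    h x * (2 * u (x, t * h x) * (a (x, t * h x) + t * h' x * b (x, t * h x)) -
      2 * v (x, t * h x) * (-b (x, t * h x) + t * h' x * a (x, t * h x))) with hF'
  -- By Cauchy–Riemann the `x`-derivative of the integrand is the `t`-derivative of `G`, so its
  -- integral is `G 1 - G 0`. Only `0 < t < 1` is needed, hence only interior second derivatives,
  -- even when the curve is the surface.
  set G : ℝ → ℝ := fun t => t * h' x₀ * (u (x₀, t * h x₀) ^ 2 - v (x₀, t * h x₀) ^ 2) +
    2 * u (x₀, t * h x₀) * v (x₀, t * h x₀) with hG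
  have hFc : ∀ x ∈ s, ContinuousOn (F x) (Icc 0 1) := fun x hx =>
    continuousOn_const.mul (scaled_continuousOn W.flux_density_cont (hCS x hx))
  have hGd : ∀ t ∈ Ioo (0 : ℝ) 1, HasDerivAt G (F' x₀ t) t := by
    intro t ht
    obtain ⟨-, -, hd⟩ := hab _ (hin x₀ hx₀ t ht)
    obtain ⟨hu, hv⟩ := hd (fun _ => x₀) (fun t => t * h x₀) 0 (h x₀) t rfl (hasDerivAt_const _ _)
      (by simpa using (hasDerivAt_id t).mul_const (h x₀))
    have := (((hasDerivAt_id t).mul_const (h' x₀)).mul ((hu.pow 2).sub (hv.pow 2))).add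
      ((hu.const_mul 2).mul hv)
    refine this.congr_deriv ?_
    simp only [hF', id, Pi.pow_apply, Pi.sub_apply]
    push_cast
    ring
  have hFd : ∀ t ∈ Ioo (0 : ℝ) 1, ∀ x ∈ s, HasDerivAt (fun x => F x t) (F' x t) x := by
    intro t ht x hx
    obtain ⟨-, -, hd⟩ := hab _ (hin x hx t ht)
    obtain ⟨hu, hv⟩ := hd (fun x => x) (fun x => t * h x) 1 (t * h' x) x rfl (hasDerivAt_id x)
      (hx.1.const_mul t)
    have := hx.1.mul ((hu.pow 2).sub (hv.pow 2))
    refine this.congr_deriv ?_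
    simp only [hF', Pi.pow_apply, Pi.sub_apply]
    push_cast
    ring
  have hone : ∀ᵐ t : ℝ, t ≠ 1 := compl_mem_ae_iff.2 (measure_singleton 1)
  have hIoo : ∀ t : ℝ, t ≠ 1 → t ∈ uIoc (0 : ℝ) 1 → t ∈ Ioo (0 : ℝ) 1 := fun t h1 h2 => by
    rw [uIoc_of_le zero_le_one] at h2
    exact ⟨h2.1, lt_of_le_of_ne h2.2 h1⟩
  -- Measurability comes for free: the integrand agrees almost everywhere with `deriv G`.
  have hmeas : AEStronglyMeasurable (F' x₀) (volume.restrict (uIoc (0 : ℝ) 1)) := by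
    refine (measurable_deriv G).aestronglyMeasurable.congr ?_
    refine (ae_restrict_iff' measurableSet_uIoc).2 ?_
    filter_upwards [hone] with t h1 h2 using (hGd t (hIoo t h1 h2)).deriv
  have hM : 0 ≤ M := (abs_nonneg _).trans hx₀.2.2.2
  obtain ⟨hint, hder⟩ := intervalIntegral.hasDerivAt_integral_of_dominated_loc_of_deriv_le
    (μ := volume) (a := (0 : ℝ)) (b := 1) (F := F) (F' := F') (x₀ := x₀)
    (bound := fun _ => M * C ^ 2 + r * (2 * C * (C + 1 * M * C) + 2 * C * (C + 1 * M * C))) hsn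
    (by
      filter_upwards [hsn] with x hx
      rw [uIoc_of_le zero_le_one]
      exact ((hFc x hx).mono Ioc_subset_Icc_self).aestronglyMeasurable measurableSet_Ioc)
    ((hFc x₀ hx₀).intervalIntegrable_of_Icc zero_le_one) hmeas
    (by
      filter_upwards [hone] with t h1 h2 x hx
      have ht := hIoo t h1 h2
      have hp := hin x hx t ht
      have hpc := fluid_subset η hp
      obtain ⟨ha, hb, -⟩ := hab _ hp
      have hr : |h x| ≤ r := by
        rw [abs_of_pos hx.2.1]; exact hx.2.2.1.trans (W.surface_le x)
      have hu := W.u_bound _ hpc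
      have hv := W.v_bound _ hpc
      have ht' : |t| ≤ 1 := by rw [abs_of_pos ht.1]; exact ht.2.le
      have hC := W.bound_pos.le
      have hr0 : 0 ≤ r := (abs_nonneg _).trans hr
      rw [Real.norm_eq_abs]
      refine (abs_add_le _ _).trans (add_le_add ?_ ?_)
      · rw [abs_mul]
        exact mul_le_mul hx.2.2.2 (W.flux_density_bound hpc) (abs_nonneg _) hM
      · rw [abs_mul]
        refine mul_le_mul hr ((abs_sub _ _).trans (add_le_add ?_ ?_)) (abs_nonneg _) hr0
        · rw [abs_mul, abs_mul, abs_two]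
          refine mul_le_mul (by linarith) ((abs_add_le _ _).trans (add_le_add ha ?_))
            (abs_nonneg _) (by positivity)
          rw [abs_mul, abs_mul]
          exact mul_le_mul (mul_le_mul ht' hx.2.2.2 (abs_nonneg _) zero_le_one) hb
            (abs_nonneg _) (by positivity)
        · rw [abs_mul, abs_mul, abs_two]
          refine mul_le_mul (by linarith) ((abs_add_le _ _).trans (add_le_add ?_ ?_))
            (abs_nonneg _) (by positivity)
          · rwa [abs_neg]
          rw [abs_mul, abs_mul]
          exact mul_le_mul (mul_le_mul ht' hx.2.2.2 (abs_nonneg _) zero_le_one) ha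
            (abs_nonneg _) (by positivity))
    intervalIntegrable_const
    (by filter_upwards [hone] with t h1 h2 x hx using hFd t (hIoo t h1 h2) x hx)
  have hGc : ContinuousOn G (Icc 0 1) := by
    exact ((continuousOn_id.mul continuousOn_const).mul
      (scaled_continuousOn W.flux_density_cont (hCS x₀ hx₀))).add
      ((continuousOn_const.mul (scaled_continuousOn W.u_cont (hCS x₀ hx₀))).mul
        (scaled_continuousOn W.v_cont (hCS x₀ hx₀)))
  have hval := intervalIntegral.integral_eq_sub_of_hasDerivAt_of_le zero_le_one hGc hGd hint
  rw [hval] at hder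
  have e : (fun x => verticalFlux u v (x, h x)) = fun x => ∫ t in (0 : ℝ)..1, F x t :=
    funext fun x => verticalFlux_eq_integral_unit u v x (h x)
  rw [e]
  refine hder.congr_deriv ?_
  simp only [hG, one_mul, zero_mul, zero_add, W.v_bottom, mul_zero, sub_zero]

theorem hasDerivAt_verticalFlux_snd (W : IsWave r C ψ u v η η') {x y : ℝ}
    (hy : y ∈ Ioo 0 (η x)) :
    HasDerivAt (fun s => verticalFlux u v (x, s)) (u (x, y) ^ 2 - v (x, y) ^ 2) y := by
  have hc := vertical_continuousOn W.flux_density_cont x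
  have hc' := hc.mono Ioo_subset_Icc_self
  refine intervalIntegral.integral_hasDerivAt_right (a := 0) (b := y)
    (f := fun y => u (x, y) ^ 2 - v (x, y) ^ 2) ?_ ?_ ?_
  · exact (hc.mono (Icc_subset_Icc_right hy.2.le)).intervalIntegrable_of_Icc hy.1.le
  · exact hc'.stronglyMeasurableAtFilter isOpen_Ioo y hy
  · exact hc'.continuousAt (isOpen_Ioo.mem_nhds hy)

theorem verticalFlux_bound (W : IsWave r C ψ u v η η') {p : ℝ × ℝ} (hp : p ∈ closedFluid η) :
    |verticalFlux u v p| ≤ C ^ 2 * r := by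
  have := intervalIntegral.norm_integral_le_of_norm_le_const (a := 0) (b := p.2) (C := C ^ 2)
    (f := fun y => u (p.1, y) ^ 2 - v (p.1, y) ^ 2) (fun y hy => by
      rw [uIoc_of_le hp.1] at hy
      exact W.flux_density_bound ⟨hy.1.le, hy.2.trans hp.2⟩)
  rw [sub_zero, abs_of_nonneg hp.1] at this
  exact this.trans (mul_le_mul_of_nonneg_left (hp.2.trans (W.surface_le _)) (sq_nonneg C))

theorem verticalFlux_cont (W : IsWave r C ψ u v η η') :
    ContinuousOn (verticalFlux u v) (closedFluid η) := by
  intro p hp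
  have e : verticalFlux u v = fun p : ℝ × ℝ =>
      ∫ t in (0 : ℝ)..1, p.2 * (u (p.1, t * p.2) ^ 2 - v (p.1, t * p.2) ^ 2) :=
    funext fun p => verticalFlux_eq_integral_unit u v p.1 p.2
  have hmem : ∀ q ∈ closedFluid η, ∀ t ∈ Icc (0 : ℝ) 1, (q.1, t * q.2) ∈ closedFluid η :=
    fun q hq t ht => ⟨mul_nonneg ht.1 hq.1, (mul_le_of_le_one_left hq.1 ht.2).trans hq.2⟩
  have hsub : ∀ t ∈ uIoc (0 : ℝ) 1, t ∈ Icc (0 : ℝ) 1 := fun t ht => by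
    rw [uIoc_of_le zero_le_one] at ht; exact Ioc_subset_Icc_self ht
  rw [e]
  refine intervalIntegral.continuousWithinAt_of_dominated_interval
    (bound := fun _ => r * C ^ 2) ?_ ?_ intervalIntegrable_const ?_
  · filter_upwards [self_mem_nhdsWithin] with q hq
    rw [uIoc_of_le zero_le_one]
    exact ((continuousOn_const.mul (scaled_continuousOn W.flux_density_cont hq)).mono
      Ioc_subset_Icc_self).aestronglyMeasurable measurableSet_Ioc
  · filter_upwards [self_mem_nhdsWithin] with q hq
    refine Eventually.of_forall fun t ht => ?_
    rw [Real.norm_eq_abs, abs_mul, abs_of_nonneg hq.1]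
    have h1 := hq.2.trans (W.surface_le _)
    exact mul_le_mul h1 (W.flux_density_bound (hmem q hq t (hsub t ht))) (abs_nonneg _)
      (hq.1.trans h1)
  · refine Eventually.of_forall fun t ht => ?_
    refine ContinuousWithinAt.mul continuous_snd.continuousWithinAt ?_
    have := (W.flux_density_cont.comp (f := fun q : ℝ × ℝ => (q.1, t * q.2)) (by fun_prop)
      fun q hq => hmem q hq t (hsub t ht)) p hp
    exact this

theorem psi_laplacian (W : IsWave r C ψ u v η η') {p : ℝ × ℝ} (hp : p ∈ fluid η) :
    HasLaplacianAt ψ 0 p := by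
  obtain ⟨a, b, hab⟩ := W.velocity_partials
  obtain ⟨-, -, hd⟩ := hab p hp
  have hn := W.fluid_mem_nhds hp
  have t1 : Tendsto (fun s : ℝ => (s, p.2)) (𝓝 p.1) (𝓝 p) :=
    (by fun_prop : Continuous (fun s : ℝ => (s, p.2))).tendsto p.1
  have t2 : Tendsto (fun s : ℝ => (p.1, s)) (𝓝 p.2) (𝓝 p) :=
    (by fun_prop : Continuous (fun s : ℝ => (p.1, s))).tendsto p.2
  refine ⟨-b p, b p, ⟨fun s => v (s, p.2), ?_, ?_⟩, ⟨fun s => u (p.1, s), ?_, ?_⟩, by ring⟩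
  · filter_upwards [t1 hn] with s hs
    obtain ⟨L, hL, h1, -⟩ := W.psi_fderiv _ hs
    rw [← h1]
    exact HasFDerivAt.comp_hasDerivAt (f := fun s => (s, p.2)) s hL
      ((hasDerivAt_id s).prodMk (hasDerivAt_const s p.2))
  · simpa using (hd (fun s => s) (fun _ => p.2) 1 0 p.1 rfl (hasDerivAt_id _)
      (hasDerivAt_const _ _)).2
  · filter_upwards [t2 hn] with s hs
    obtain ⟨L, hL, -, h1⟩ := W.psi_fderiv _ hs
    rw [← h1]
    exact HasFDerivAt.comp_hasDerivAt (f := fun s => (p.1, s)) s hL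
      ((hasDerivAt_const s p.1).prodMk (hasDerivAt_id s))
  · simpa using (hd (fun _ => p.1) (fun s => s) 0 1 p.2 rfl (hasDerivAt_const _ _)
      (hasDerivAt_id _)).1

theorem hasDerivAt_psi_snd (W : IsWave r C ψ u v η η') {x y : ℝ} (hy : y ∈ Ioo 0 (η x)) :
    HasDerivAt (fun s => ψ (x, s)) (u (x, y)) y := by
  obtain ⟨L, hL, -, h1⟩ := W.psi_fderiv (x, y) hy
  rw [← h1]
  exact HasFDerivAt.comp_hasDerivAt (f := fun s => (x, s)) y hL
    ((hasDerivAt_const y x).prodMk (hasDerivAt_id y))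

/-- The gradient of the flux is `(2uv, u² - v²)`, and the Cauchy–Riemann equations make its
divergence vanish. -/
theorem verticalFlux_laplacian (W : IsWave r C ψ u v η η') {p : ℝ × ℝ} (hp : p ∈ fluid η) :
    HasLaplacianAt (verticalFlux u v) 0 p := by
  obtain ⟨a, b, hab⟩ := W.velocity_partials
  obtain ⟨-, -, hd⟩ := hab p hp
  have hn := W.fluid_mem_nhds hp
  have t1 : Tendsto (fun s : ℝ => (s, p.2)) (𝓝 p.1) (𝓝 p) :=
    (by fun_prop : Continuous (fun s : ℝ => (s, p.2))).tendsto p.1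
  have t2 : Tendsto (fun s : ℝ => (p.1, s)) (𝓝 p.2) (𝓝 p) :=
    (by fun_prop : Continuous (fun s : ℝ => (p.1, s))).tendsto p.2
  obtain ⟨u1, v1⟩ := hd (fun s => s) (fun _ => p.2) 1 0 p.1 rfl (hasDerivAt_id _)
    (hasDerivAt_const _ _)
  obtain ⟨u2, v2⟩ := hd (fun _ => p.1) (fun s => s) 0 1 p.2 rfl (hasDerivAt_const _ _)
    (hasDerivAt_id _)
  refine ⟨_, _, ⟨fun s => 2 * u (s, p.2) * v (s, p.2), ?_, (u1.const_mul 2).mul v1⟩,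
    ⟨fun s => u (p.1, s) ^ 2 - v (p.1, s) ^ 2, ?_, (u2.pow 2).sub (v2.pow 2)⟩, ?_⟩
  · filter_upwards [eventually_eventually_nhds.2 (t1 hn)] with s hs
    have := W.hasDerivAt_verticalFlux_curve (h := fun _ => p.2) (h' := fun _ => 0) (x₀ := s)
      (M := 0) (by
        filter_upwards [hs] with x hx using ⟨hasDerivAt_const _ _, hx.1, hx.2.le, by simp⟩)
    simpa using this
  · filter_upwards [t2 hn] with s hs using W.hasDerivAt_verticalFlux_snd hs
  · push_cast
    ring

/-- The surface value of the flux is determined by the depth up to a constant. -/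
theorem exists_verticalFlux_top (W : IsWave r C ψ u v η η') :
    ∃ c, ∀ x, verticalFlux u v (x, η x) = c + (r - η x) ^ 2 := by
  have hd : ∀ x, HasDerivAt (fun x => verticalFlux u v (x, η x) - (r - η x) ^ 2) 0 x := by
    intro x
    have h1 := W.hasDerivAt_verticalFlux_curve (h := η) (h' := η') (x₀ := x) (M := C)
      (Eventually.of_forall fun x =>
        ⟨W.surface_deriv x, W.depth_pos x, le_rfl, W.slope_bound x⟩)
    have h2 := ((W.surface_deriv x).const_sub r).pow 2
    refine (h1.sub h2).congr_deriv ?_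
    -- With `v = -uη'` the derivative along the surface is `η'` times `-(u² + v²) + 2(r - η)`, which
    -- Bernoulli's law kills.
    have hb := W.bernoulli x
    rw [W.v_top] at hb ⊢
    push_cast
    linear_combination (-η' x) * hb
  have hconst := is_const_of_deriv_eq_zero (fun x => (hd x).differentiableAt)
    fun x => (hd x).deriv
  exact ⟨verticalFlux u v (0, η 0) - (r - η 0) ^ 2, fun x => by linarith [hconst x 0]⟩

end IsWave

/-- Inserting the surface value `c + (r - η)²` cancels `η`, leaving the constant `(c + r²)/2`. -/
theorem SteadyWave.flowForce_eq_verticalFlux {r C : ℝ} {ψ : ℝ × ℝ → ℝ} {η η' : ℝ → ℝ}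
    (W : IsWave r C ψ (partialY (closedFluid η) ψ) (partialX (closedFluid η) ψ) η η') (x : ℝ) :
    flowForce r ψ η x = verticalFlux (partialY (closedFluid η) ψ) (partialX (closedFluid η) ψ)
      (x, η x) / 2 + r * η x - η x ^ 2 / 2 := by
  have hc := (IsWave.vertical_continuousOn W.flux_density_cont x).intervalIntegrable_of_Icc
    (μ := volume) (W.depth_pos x).le
  have e : ∀ y : ℝ, (1 / 2) * (partialY (closedFluid η) ψ (x, y) ^ 2 -
      partialX (closedFluid η) ψ (x, y) ^ 2) - y + r =
      (1 / 2) * (partialY (closedFluid η) ψ (x, y) ^ 2 -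
      partialX (closedFluid η) ψ (x, y) ^ 2) + (r - y) := fun y => by ring
  simp only [flowForce, e]
  have hc2 : IntervalIntegrable (fun y : ℝ => r - y) volume 0 (η x) :=
    (by fun_prop : Continuous fun y : ℝ => r - y).intervalIntegrable _ _
  rw [intervalIntegral.integral_add (hc.const_mul _) hc2,
    intervalIntegral.integral_const_mul, intervalIntegral.integral_sub
      (intervalIntegrable_const) (continuous_id'.intervalIntegrable _ _), integral_id,
    intervalIntegral.integral_const]
  simp only [verticalFlux, smul_eq_mul]
  ring

/-! ### Affine comparison and the uniform Hopf bound. -/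

namespace IsWave

variable {r C : ℝ} {ψ u v : ℝ × ℝ → ℝ} {η η' : ℝ → ℝ}

theorem affine_le (W : IsWave r C ψ u v η η') {f : ℝ × ℝ → ℝ} {B k m : ℝ}
    (hf : ContinuousOn f (closedFluid η)) (hB : ∀ p ∈ closedFluid η, |f p| ≤ B)
    (hL : ∀ p ∈ fluid η, HasLaplacianAt f 0 p) (hb : ∀ x, m ≤ f (x, 0))
    (ht : ∀ x, k * η x + m ≤ f (x, η x)) : ∀ p ∈ closedFluid η, k * p.2 + m ≤ f p := by
  have key := nonpos_of_laplacian_nonneg (D := closedFluid η) (U := fluid η)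
    (w := fun p => (0 * p.1 ^ 2 + 0 * p.1 + 0 * p.2 ^ 2 + k * p.2 + m) + (-1) * f p)
    (R := r) (A := |k| * r + |m| + B) (isClosed_closedFluid W.continuous_surface)
    (isOpen_fluid W.continuous_surface) (fluid_subset η)
    (fun p hp => by
      rw [abs_of_nonneg hp.1]; exact hp.2.trans (W.surface_le _))
    (by
      refine ContinuousOn.add (Continuous.continuousOn (by fun_prop)) (continuousOn_const.mul hf))
    (fun p hp => by
      have h1 : k * p.2 ≤ |k| * r := (le_abs_self _).trans (by
        rw [abs_mul, abs_of_nonneg hp.1]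
        exact mul_le_mul_of_nonneg_left (hp.2.trans (W.surface_le _)) (abs_nonneg _))
      have h2 := (abs_le.1 (hB p hp)).1
      have h3 := le_abs_self m
      linarith)
    (fun p hp hpU => by
      rcases p with ⟨x, y⟩
      rcases hp.1.eq_or_lt with h0 | h0
      · have h0 : 0 = y := h0
        subst h0
        have := hb x
        simp only
        linarith
      · rcases hp.2.eq_or_lt with h1 | h1
        · have h1 : y = η x := h1
          subst h1
          have := ht x
          simp only
          linarith
        · exact absurd ⟨h0, h1⟩ hpU)
    (fun p hp => ⟨_, le_of_eq (by ring), (hasLaplacianAt_quadratic 0 0 0 k m p).add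
      ((hL p hp).const_mul (-1))⟩)
  intro p hp
  have := key p hp
  linarith

theorem le_affine (W : IsWave r C ψ u v η η') {f : ℝ × ℝ → ℝ} {B k m : ℝ}
    (hf : ContinuousOn f (closedFluid η)) (hB : ∀ p ∈ closedFluid η, |f p| ≤ B)
    (hL : ∀ p ∈ fluid η, HasLaplacianAt f 0 p) (hb : ∀ x, f (x, 0) ≤ m)
    (ht : ∀ x, f (x, η x) ≤ k * η x + m) : ∀ p ∈ closedFluid η, f p ≤ k * p.2 + m := by
  intro p hp
  have := W.affine_le (f := fun p => (-1) * f p) (B := B) (k := -k) (m := -m)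
    (continuousOn_const.mul hf) (fun p hp => by simpa using hB p hp)
    (fun p hp => by simpa using (hL p hp).const_mul (-1)) (fun x => by linarith [hb x])
    (fun x => by linarith [ht x]) p hp
  linarith

theorem psi_taylor (W : IsWave r C ψ u v η η') {x a b : ℝ} (ha : a ∈ Icc 0 (η x))
    (hb : b ∈ Icc 0 (η x)) : |ψ (x, b) - ψ (x, a) - u (x, a) * (b - a)| ≤ C * (b - a) ^ 2 :=
  abs_sub_sub_le_of_lipschitz_deriv (vertical_continuousOn W.psi_cont x)
    (fun _ hy => W.hasDerivAt_psi_snd hy) (W.u_lipschitz x) ha hb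

theorem verticalFlux_taylor (W : IsWave r C ψ u v η η') {x a b : ℝ} (ha : a ∈ Icc 0 (η x))
    (hb : b ∈ Icc 0 (η x)) :
    |verticalFlux u v (x, b) - verticalFlux u v (x, a) - (u (x, a) ^ 2 - v (x, a) ^ 2) * (b - a)|
      ≤ 4 * C ^ 2 * (b - a) ^ 2 := by
  refine abs_sub_sub_le_of_lipschitz_deriv (f := fun y => verticalFlux u v (x, y))
    (f' := fun y => u (x, y) ^ 2 - v (x, y) ^ 2) (vertical_continuousOn W.verticalFlux_cont x)
    (fun _ hy => W.hasDerivAt_verticalFlux_snd hy) ?_ ha hb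
  have hC := W.bound_pos.le
  have hsq : ∀ s t d : ℝ, |s| ≤ C → |t| ≤ C → |s - t| ≤ C * d →
      |s ^ 2 - t ^ 2| ≤ 2 * C * (C * d) := by
    intro s t d hs ht hd
    rw [sq_sub_sq, abs_mul]
    exact mul_le_mul ((abs_add_le _ _).trans (by linarith)) hd (abs_nonneg _) (by positivity)
  intro y hy z hz
  have h1 := hsq _ _ _ (W.u_bound (x, y) hy) (W.u_bound (x, z) hz) (W.u_lipschitz x y hy z hz)
  have h2 := hsq _ _ _ (W.v_bound (x, y) hy) (W.v_bound (x, z) hz) (W.v_lipschitz x y hy z hz)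
  calc |u (x, y) ^ 2 - v (x, y) ^ 2 - (u (x, z) ^ 2 - v (x, z) ^ 2)|
      = |(u (x, y) ^ 2 - u (x, z) ^ 2) - (v (x, y) ^ 2 - v (x, z) ^ 2)| := by congr 1; ring
    _ ≤ _ := (abs_sub _ _).trans (add_le_add h1 h2)
    _ = _ := by ring

theorem surface_taylor (W : IsWave r C ψ u v η η') (a b : ℝ) :
    |η b - η a - η' a * (b - a)| ≤ C * (b - a) ^ 2 :=
  abs_sub_sub_le_of_lipschitz_deriv (l := min a b) (h := max a b)
    W.continuous_surface.continuousOn (fun y _ => W.surface_deriv y)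
    (fun y _ z _ => W.slope_lipschitz y z) ⟨min_le_left _ _, le_max_left _ _⟩
    ⟨min_le_right _ _, le_max_right _ _⟩

/-- `ψ` must rise from `0` to `1` with slope at most `C`. -/
theorem inv_bound_le_surface (W : IsWave r C ψ u v η η') (x : ℝ) : 1 / C ≤ η x := by
  obtain ⟨c, hc, hce⟩ := exists_hasDerivAt_eq_slope (fun y => ψ (x, y)) (fun y => u (x, y))
    (W.depth_pos x) (vertical_continuousOn W.psi_cont x) (fun y hy => W.hasDerivAt_psi_snd hy)
  have hd := W.depth_pos x
  rw [eq_div_iff (by linarith), W.top, W.bottom] at hce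
  have h1 := (abs_le.1 (W.u_bound (x, c) ⟨hc.1.le, hc.2.le⟩)).2
  rw [div_le_iff₀ W.bound_pos]
  nlinarith

theorem psi_le_one (W : IsWave r C ψ u v η η') : ∀ p ∈ closedFluid η, ψ p ≤ 1 := by
  intro p hp
  have := W.le_affine (k := 0) (m := 1) W.psi_cont W.psi_bound (fun p hp => W.psi_laplacian hp)
    (fun x => by rw [W.bottom]; norm_num) (fun x => by rw [W.top]; norm_num) p hp
  simpa using this

theorem top_mem (W : IsWave r C ψ u v η η') (x : ℝ) : η x ∈ Icc 0 (η x) :=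
  ⟨(W.depth_pos x).le, le_rfl⟩

theorem below_top_mem (W : IsWave r C ψ u v η η') (x : ℝ) {t : ℝ} (ht : 0 < t)
    (ht' : t ≤ 1 / C) : η x - t ∈ Icc 0 (η x) :=
  ⟨by linarith [W.inv_bound_le_surface x], by linarith⟩

theorem hasSecondDerivAt_exp {f f' : ℝ → ℝ} {f'' x : ℝ} (h1 : ∀ y, HasDerivAt f (f' y) y)
    (h2 : HasDerivAt f' f'' x) :
    HasSecondDerivAt (fun y => Real.exp (f y)) (Real.exp (f x) * (f' x ^ 2 + f'')) x := by
  refine ⟨fun y => Real.exp (f y) * f' y, Eventually.of_forall fun y => (h1 y).exp, ?_⟩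
  exact ((h1 x).exp.mul h2).congr_deriv (by ring)

/-- A uniform version of the Hopf lemma: the surface speed is bounded away from zero. -/
theorem exists_le_u_top (W : IsWave r C ψ u v η η') : ∃ β, 0 < β ∧ ∀ x, β ≤ u (x, η x) := by
  have hC := W.bound_pos
  -- The barrier is `α(exp(k(P - y)) - 1) ≤ 1 - ψ` below the parabola `P`, which touches the surface
  -- from below at `x₀`. Since `P'' = -2C`, the choice `k = 2C` makes the exponential subharmonic;
  -- `α = exp(-kr)` keeps `α exp(k(P - y)) ≤ 1`, which gives the inequality on the bed.
  set k := 2 * C with hk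
  set α := Real.exp (-(k * r)) with hα
  have hα0 : 0 < α := Real.exp_pos _
  refine ⟨α * k, by positivity, fun x₀ => ?_⟩
  set P : ℝ → ℝ := fun x => η x₀ + η' x₀ * (x - x₀) - C * (x - x₀) ^ 2 with hP
  have hPc : Continuous P := by rw [hP]; fun_prop
  have hPη : ∀ x, P x ≤ η x := fun x => by
    have := (abs_le.1 (W.surface_taylor x₀ x)).1
    simp only [hP]; linarith
  have hP1 : ∀ x, HasDerivAt P (η' x₀ - 2 * C * (x - x₀)) x := fun x => by
    have h := (hasDerivAt_id x).sub_const x₀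
    have := ((h.const_mul (η' x₀)).const_add (η x₀)).sub ((h.pow 2).const_mul C)
    refine this.congr_deriv ?_
    simp; ring
  have hP2 : ∀ x, HasDerivAt (fun x => η' x₀ - 2 * C * (x - x₀)) (-(2 * C)) x := fun x => by
    simpa using (((hasDerivAt_id x).sub_const x₀).const_mul (2 * C)).const_sub (η' x₀)
  have hsub : ∀ p : ℝ × ℝ, 0 ≤ p.2 ∧ p.2 ≤ P p.1 → p ∈ closedFluid η := fun p hp =>
    ⟨hp.1, hp.2.trans (hPη _)⟩
  have hE : ∀ p : ℝ × ℝ, 0 ≤ p.2 → α * Real.exp (k * (P p.1 - p.2)) ≤ 1 := fun p hp => by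
    rw [hα, ← Real.exp_add, Real.exp_le_one_iff]
    have : P p.1 - p.2 ≤ r := by linarith [hPη p.1, W.surface_le p.1]
    nlinarith
  have key := nonpos_of_laplacian_nonneg (D := {p : ℝ × ℝ | 0 ≤ p.2 ∧ p.2 ≤ P p.1})
    (U := {p : ℝ × ℝ | 0 < p.2 ∧ p.2 < P p.1})
    (w := fun p => α * Real.exp (k * (P p.1 - p.2)) +
      ((0 * p.1 ^ 2 + 0 * p.1 + 0 * p.2 ^ 2 + 0 * p.2 + (-(1 + α))) + ψ p))
    (R := r) (A := 1 + (-(1 + α)) + C)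
    ((isClosed_le continuous_const continuous_snd).inter
      (isClosed_le continuous_snd (hPc.comp continuous_fst)))
    ((isOpen_lt continuous_const continuous_snd).inter
      (isOpen_lt continuous_snd (hPc.comp continuous_fst)))
    (fun p hp => ⟨hp.1.le, hp.2.le⟩)
    (fun p hp => by
      rw [abs_of_nonneg hp.1]; exact hp.2.trans ((hPη _).trans (W.surface_le _)))
    (by
      refine ContinuousOn.add (Continuous.continuousOn (by fun_prop))
        (ContinuousOn.add (Continuous.continuousOn (by fun_prop))
          (W.psi_cont.mono fun p hp => hsub p hp)))
    (fun p hp => by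
      have h1 := hE p hp.1
      have h2 := (abs_le.1 (W.psi_bound p (hsub p hp))).2
      linarith)
    (fun p hp hpU => by
      rcases hp.1.eq_or_lt with h0 | h0
      · have h1 := hE p hp.1
        have h2 : ψ p = 0 := by
          have := W.bottom p.1
          rwa [show (p.1, (0 : ℝ)) = p from Prod.ext rfl h0] at this
        linarith
      · rcases hp.2.eq_or_lt with h1 | h1
        · have h2 := W.psi_le_one p (hsub p hp)
          rw [h1, sub_self, mul_zero, Real.exp_zero]
          linarith
        · exact absurd ⟨h0, h1⟩ hpU)
    (fun p hp => by
      have hpf : p ∈ fluid η := ⟨hp.1, hp.2.trans_le (hPη _)⟩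
      have hx := hasSecondDerivAt_exp (f := fun s => k * (P s - p.2))
        (f' := fun s => k * (η' x₀ - 2 * C * (s - x₀))) (x := p.1)
        (fun s => ((hP1 s).sub_const p.2).const_mul k) ((hP2 p.1).const_mul k)
      have hy := hasSecondDerivAt_exp (f := fun s => k * (P p.1 - s))
        (f' := fun _ => k * (-1)) (x := p.2)
        (fun s => ((hasDerivAt_id s).const_sub (P p.1)).const_mul k) (hasDerivAt_const _ _)
      have hlap : HasLaplacianAt (fun p => Real.exp (k * (P p.1 - p.2))) _ p :=
        ⟨_, _, hx, hy, rfl⟩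
      refine ⟨_, ?_, (hlap.const_mul α).add ((hasLaplacianAt_quadratic 0 0 0 0 (-(1 + α)) p).add
        (W.psi_laplacian hpf))⟩
      have e : ∀ E d : ℝ, 0 ≤ E → 0 ≤ α * (E * ((k * d) ^ 2 + k * -(2 * C)) +
          E * ((k * -1) ^ 2 + 0)) + (2 * 0 + 2 * 0 + 0) := by
        intro E d hE0
        have : α * (E * ((k * d) ^ 2 + k * -(2 * C)) + E * ((k * -1) ^ 2 + 0)) +
          (2 * 0 + 2 * 0 + 0) = α * E * (k * d) ^ 2 := by rw [hk]; ring
        rw [this]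
        positivity
      exact e _ _ (Real.exp_pos _).le)
  -- Both sides of the barrier inequality vanish at the contact point; comparing slopes there gives
  -- `αk ≤ u`.
  refine le_of_forall_small_le_add_mul (K := C) (t₀ := 1 / C) (by positivity) fun t ht ht' => ?_
  have hmem := W.below_top_mem x₀ ht ht'
  have h1 := key (x₀, η x₀ - t) ⟨hmem.1, by simp [hP, ht.le]⟩
  have h2 := (abs_le.1 (W.psi_taylor (W.top_mem x₀) hmem)).1
  have hPx : P x₀ = η x₀ := by simp [hP]
  rw [W.top] at h2
  simp only [hPx, sub_sub_cancel] at h1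
  have h3 := Real.add_one_le_exp (k * t)
  have h4 := mul_le_mul_of_nonneg_left h3 hα0.le
  have h5 : (α * k) * t ≤ (u (x₀, η x₀) + C * t) * t := by linarith
  exact le_of_mul_le_mul_right h5 ht

/-! ### Speeds at the crest and trough levels. -/

/-- Moving by `η'/(2C)` downhill lowers the surface by at least `η'²/(4C)`, yet it cannot pass below
`h`. Slopes therefore tend to zero along extremizing sequences, even if the extremum is not
attained. -/
theorem slope_sq_le_of_forall_ge (W : IsWave r C ψ u v η η') {h : ℝ} (hh : ∀ x, h ≤ η x) (x : ℝ) :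
    η' x ^ 2 ≤ 4 * C * (η x - h) := by
  have hC := W.bound_pos
  have h1 := (abs_le.1 (W.surface_taylor x (x - η' x / (2 * C)))).2
  have h2 := hh (x - η' x / (2 * C))
  have e1 : η' x * (x - η' x / (2 * C) - x) = -(η' x ^ 2 / (2 * C)) := by ring
  have e2 : C * (x - η' x / (2 * C) - x) ^ 2 = η' x ^ 2 / (2 * C) / 2 := by field_simp; ring
  rw [e1, e2] at h1
  have h3 : η' x ^ 2 / (2 * C) ≤ 2 * (η x - h) := by linarith
  rw [div_le_iff₀ (by positivity)] at h3
  linarith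

theorem slope_sq_le_of_forall_le (W : IsWave r C ψ u v η η') {h : ℝ} (hh : ∀ x, η x ≤ h) (x : ℝ) :
    η' x ^ 2 ≤ 4 * C * (h - η x) := by
  have hC := W.bound_pos
  have h1 := (abs_le.1 (W.surface_taylor x (x + η' x / (2 * C)))).1
  have h2 := hh (x + η' x / (2 * C))
  have e1 : η' x * (x + η' x / (2 * C) - x) = η' x ^ 2 / (2 * C) := by ring
  have e2 : C * (x + η' x / (2 * C) - x) ^ 2 = η' x ^ 2 / (2 * C) / 2 := by field_simp; ring
  rw [e1, e2] at h1
  have h3 : η' x ^ 2 / (2 * C) ≤ 2 * (h - η x) := by linarith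
  rw [div_le_iff₀ (by positivity)] at h3
  linarith

/-- Bernoulli's law determines `u²(1 + η'²)`; the Hopf bound selects the positive root. -/
theorem u_top_tendsto (W : IsWave r C ψ u v η η') {x : ℕ → ℝ} {h : ℝ}
    (hx : Tendsto (fun n => η (x n)) atTop (𝓝 h))
    (hx' : Tendsto (fun n => η' (x n) ^ 2) atTop (𝓝 0)) :
    Tendsto (fun n => u (x n, η (x n))) atTop (𝓝 (Real.sqrt (2 * (r - h)))) := by
  obtain ⟨β, hβ, hu⟩ := W.exists_le_u_top
  have e : (fun n => u (x n, η (x n))) =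
      fun n => Real.sqrt (2 * (r - η (x n)) / (1 + η' (x n) ^ 2)) := by
    ext n
    rw [← W.bernoulli, W.v_top, neg_mul, neg_sq, mul_pow, ← mul_one_add,
      mul_div_cancel_right₀ _ (by positivity), Real.sqrt_sq (hβ.le.trans (hu _))]
  rw [e]
  refine Tendsto.sqrt ?_
  have := ((hx.const_sub r).const_mul 2).div (hx'.const_add 1) (by norm_num)
  rw [add_zero, div_one] at this
  exact this

theorem exists_seq_tendsto_crest (W : IsWave r C ψ u v η η') {h : ℝ}
    (hh : IsLUB (range η) h) : ∃ x : ℕ → ℝ, Tendsto (fun n => η (x n)) atTop (𝓝 h) ∧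
      Tendsto (fun n => η' (x n) ^ 2) atTop (𝓝 0) := by
  obtain ⟨w, -, -, hw, hmem⟩ := hh.exists_seq_monotone_tendsto (range_nonempty η)
  choose x hx using hmem
  obtain rfl : (fun n => η (x n)) = w := funext hx
  refine ⟨x, hw, squeeze_zero (fun n => sq_nonneg _)
    (fun n => W.slope_sq_le_of_forall_le (fun y => hh.1 (mem_range_self y)) (x n)) ?_⟩
  simpa using (hw.const_sub h).const_mul (4 * C)

theorem exists_seq_tendsto_trough (W : IsWave r C ψ u v η η') {h : ℝ}
    (hh : IsGLB (range η) h) : ∃ x : ℕ → ℝ, Tendsto (fun n => η (x n)) atTop (𝓝 h) ∧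
      Tendsto (fun n => η' (x n) ^ 2) atTop (𝓝 0) := by
  obtain ⟨w, -, -, hw, hmem⟩ := hh.exists_seq_antitone_tendsto (range_nonempty η)
  choose x hx using hmem
  obtain rfl : (fun n => η (x n)) = w := funext hx
  refine ⟨x, hw, squeeze_zero (fun n => sq_nonneg _)
    (fun n => W.slope_sq_le_of_forall_ge (fun y => hh.1 (mem_range_self y)) (x n)) ?_⟩
  simpa using (hw.sub_const h).const_mul (4 * C)

/-- The uniform lower bound on surface speed excludes stagnation, even in the limit. -/
theorem crest_lt (W : IsWave r C ψ u v η η') {h : ℝ} (hh : IsLUB (range η) h) : h < r := by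
  obtain ⟨β, hβ, hu⟩ := W.exists_le_u_top
  have : h ≤ r - β ^ 2 / 2 := hh.2 (by
    rintro _ ⟨x, rfl⟩
    have h1 := W.bernoulli x
    have h2 := pow_le_pow_left₀ hβ.le (hu x) 2
    nlinarith [sq_nonneg (v (x, η x))])
  nlinarith [sq_nonneg β, pow_pos hβ 2]

theorem div_crest_le_psi (W : IsWave r C ψ u v η η') {h : ℝ} (hh : ∀ x, η x ≤ h) :
    ∀ p ∈ closedFluid η, p.2 / h ≤ ψ p := by
  intro p hp
  have h0 : 0 < h := (W.depth_pos 0).trans_le (hh 0)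
  have := W.affine_le (k := 1 / h) (m := 0) W.psi_cont W.psi_bound
    (fun p hp => W.psi_laplacian hp) (fun x => by rw [W.bottom]) (fun x => by
      rw [W.top, add_zero, one_div_mul_eq_div]; exact (div_le_one h0).2 (hh x)) p hp
  rwa [add_zero, one_div_mul_eq_div] at this

theorem psi_le_div_trough (W : IsWave r C ψ u v η η') {h : ℝ} (h0 : 0 < h) (hh : ∀ x, h ≤ η x) :
    ∀ p ∈ closedFluid η, ψ p ≤ p.2 / h := by
  intro p hp
  have := W.le_affine (k := 1 / h) (m := 0) W.psi_cont W.psi_bound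
    (fun p hp => W.psi_laplacian hp) (fun x => by rw [W.bottom]) (fun x => by
      rw [W.top, add_zero, one_div_mul_eq_div]; exact (one_le_div h0).2 (hh x)) p hp
  rwa [add_zero, one_div_mul_eq_div] at this

/-- Along a sequence approaching the crest level, `ψ` lies above `y/h` and the two nearly agree at
the surface, so the limiting speed is at most `1/h`. -/
theorem crest_speed_le (W : IsWave r C ψ u v η η') {h : ℝ} (hh : IsLUB (range η) h) :
    2 * (r - h) ≤ 1 / h ^ 2 := by
  have hC := W.bound_pos
  have hle : ∀ x, η x ≤ h := fun x => hh.1 (mem_range_self x)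
  have h0 : 0 < h := (W.depth_pos 0).trans_le (hle 0)
  obtain ⟨x, hx, hx'⟩ := W.exists_seq_tendsto_crest hh
  have hu := W.u_top_tendsto hx hx'
  have key : Real.sqrt (2 * (r - h)) ≤ 1 / h := by
    refine le_of_forall_small_le_add_mul (K := C) (t₀ := 1 / C) (by positivity) fun t ht ht' => ?_
    have h1 : (h - t) / h ≤ 1 - Real.sqrt (2 * (r - h)) * t + C * t ^ 2 := by
      refine le_of_tendsto_of_tendsto' ((hx.sub_const t).div_const h)
        (((hu.mul_const t).const_sub 1).add_const (C * t ^ 2)) fun n => ?_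
      have hmem := W.below_top_mem (x n) ht ht'
      have h2 := (abs_le.1 (W.psi_taylor (W.top_mem (x n)) hmem)).2
      have h3 := W.div_crest_le_psi hle (x n, η (x n) - t) hmem
      rw [W.top] at h2
      simp only at h3
      linarith
    rw [sub_div, div_self h0.ne'] at h1
    have h5 : Real.sqrt (2 * (r - h)) * t ≤ (1 / h + C * t) * t := by
      rw [add_mul, one_div_mul_eq_div]; linarith
    exact le_of_mul_le_mul_right h5 ht
  have := W.crest_lt hh
  have h6 := pow_le_pow_left₀ (Real.sqrt_nonneg _) key 2
  rwa [Real.sq_sqrt (by linarith), div_pow, one_pow] at h6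

theorem le_trough_speed (W : IsWave r C ψ u v η η') {h : ℝ} (hh : IsGLB (range η) h) :
    1 / h ^ 2 ≤ 2 * (r - h) := by
  have hC := W.bound_pos
  have hle : ∀ x, h ≤ η x := fun x => hh.1 (mem_range_self x)
  have h0 : 0 < h := (by positivity : 0 < 1 / C).trans_le
    (hh.2 (by rintro _ ⟨x, rfl⟩; exact W.inv_bound_le_surface x))
  obtain ⟨x, hx, hx'⟩ := W.exists_seq_tendsto_trough hh
  have hu := W.u_top_tendsto hx hx'
  have key : 1 / h ≤ Real.sqrt (2 * (r - h)) := by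
    refine le_of_forall_small_le_add_mul (K := C) (t₀ := 1 / C) (by positivity) fun t ht ht' => ?_
    have h1 : 1 - Real.sqrt (2 * (r - h)) * t - C * t ^ 2 ≤ (h - t) / h := by
      refine le_of_tendsto_of_tendsto' (((hu.mul_const t).const_sub 1).sub_const (C * t ^ 2))
        ((hx.sub_const t).div_const h) fun n => ?_
      have hmem := W.below_top_mem (x n) ht ht'
      have h2 := (abs_le.1 (W.psi_taylor (W.top_mem (x n)) hmem)).1
      have h3 := W.psi_le_div_trough h0 hle (x n, η (x n) - t) hmem
      rw [W.top] at h2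
      simp only at h3
      linarith
    rw [sub_div, div_self h0.ne'] at h1
    have h5 : 1 / h * t ≤ (Real.sqrt (2 * (r - h)) + C * t) * t := by
      rw [one_div_mul_eq_div]; linarith
    exact le_of_mul_le_mul_right h5 ht
  have h6 := pow_le_pow_left₀ (by positivity) key 2
  rwa [Real.sq_sqrt (by linarith [hle 0, W.surface_le 0]), div_pow, one_pow] at h6

/-! ### Positivity of the flux constant. -/

theorem isLaminar_of_forall_eq (W : IsWave r C ψ u v η η') {d : ℝ} (hd : ∀ x, η x = d) :
    IsLaminar ψ η := by
  refine ⟨⟨d, hd⟩, fun y => y / d, fun p hp => le_antisymm ?_ ?_⟩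
  · exact W.psi_le_div_trough (by rw [← hd 0]; exact W.depth_pos 0) (fun x => (hd x).ge) p hp
  · exact W.div_crest_le_psi (fun x => (hd x).le) p hp

/-- The constant in the surface value of the flux is positive unless the wave is laminar. -/
theorem verticalFlux_const_pos (W : IsWave r C ψ u v η η') (hlam : ¬ IsLaminar ψ η) {c : ℝ}
    (hc : ∀ x, verticalFlux u v (x, η x) = c + (r - η x) ^ 2) : 0 < c := by
  have hC := W.bound_pos
  obtain ⟨hp, hhp⟩ : ∃ h, IsLUB (range η) h := ⟨_, isLUB_csSup (range_nonempty η)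
    ⟨r, by rintro _ ⟨x, rfl⟩; exact W.surface_le x⟩⟩
  obtain ⟨hm, hhm⟩ : ∃ h, IsGLB (range η) h := ⟨_, isGLB_csInf (range_nonempty η)
    ⟨0, by rintro _ ⟨x, rfl⟩; exact (W.depth_pos x).le⟩⟩
  have hlep : ∀ x, η x ≤ hp := fun x => hhp.1 (mem_range_self x)
  have hlem : ∀ x, hm ≤ η x := fun x => hhm.1 (mem_range_self x)
  have hm0 : 0 < hm := (by positivity : 0 < 1 / C).trans_le
    (hhm.2 (by rintro _ ⟨x, rfl⟩; exact W.inv_bound_le_surface x))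
  have hlt : hm < hp := by
    by_contra! hcon
    exact hlam (W.isLaminar_of_forall_eq (d := hp) fun x =>
      le_antisymm (hlep x) (hcon.trans (hlem x)))
  have hp0 : 0 < hp := hm0.trans hlt
  have hcrest := W.crest_speed_le hhp
  have htrough := W.le_trough_speed hhm
  -- Otherwise `hm < hp < 1`, while the two speed bounds give `1/hm² + 2hm ≤ 2r ≤ 1/hp² + 2hp`,
  -- against strict monotonicity of `1/s² + 2s` on `(0, 1]`.
  have hone : 1 ≤ hp := by
    by_contra! hcon
    have h1 : 1 / hm ^ 2 + 2 * hm ≤ 1 / hp ^ 2 + 2 * hp := by linarith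
    have e1 : 1 / hm ^ 2 + 2 * hm = (hp ^ 2 + 2 * hm ^ 3 * hp ^ 2) / (hm ^ 2 * hp ^ 2) := by
      field_simp
    have e2 : 1 / hp ^ 2 + 2 * hp = (hm ^ 2 + 2 * hp ^ 3 * hm ^ 2) / (hm ^ 2 * hp ^ 2) := by
      field_simp
    rw [e1, e2, div_le_div_iff_of_pos_right (by positivity)] at h1
    have h2 : (hp - hm) * (hp + hm - 2 * hm ^ 2 * hp ^ 2) ≤ 0 := by nlinarith
    have h3 : hm * hp < 1 := by nlinarith
    have h4 : hm * hp * (hm * hp) < hm * hp := by nlinarith [mul_pos hm0 hp0]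
    have h5 : hm * hp < hm := by nlinarith
    have h6 : 0 < hp + hm - 2 * hm ^ 2 * hp ^ 2 := by nlinarith
    nlinarith [mul_pos (sub_pos.2 hlt) h6]
  have h3 : r < 3 * hp := by
    have : 1 / hp ^ 2 ≤ 1 := by
      rw [div_le_one (by positivity)]; nlinarith
    linarith
  have hσ := W.crest_lt hhp
  by_contra! hc0
  set m := c + (r - hp) ^ 2 with hm_def
  have htop : ∀ x, m ≤ verticalFlux u v (x, η x) := fun x => by
    rw [hc x]
    have := hlep x
    nlinarith
  obtain ⟨x, hx, hx'⟩ := W.exists_seq_tendsto_crest hhp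
  have hu := W.u_top_tendsto hx hx'
  have hg : Tendsto (fun n => u (x n, η (x n)) ^ 2 - v (x n, η (x n)) ^ 2) atTop
      (𝓝 (2 * (r - hp))) := by
    have e : ∀ n, u (x n, η (x n)) ^ 2 - v (x n, η (x n)) ^ 2 =
        u (x n, η (x n)) ^ 2 * (1 - η' (x n) ^ 2) := fun n => by rw [W.v_top]; ring
    simp only [e]
    have := (hu.pow 2).mul (hx'.const_sub 1)
    rwa [Real.sq_sqrt (by linarith), sub_zero, mul_one] at this
  have hH : Tendsto (fun n => verticalFlux u v (x n, η (x n))) atTop (𝓝 m) := by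
    simp only [hc]
    exact ((hx.const_sub r).pow 2).const_add c
  -- An affine minorant of the flux that meets it in the limit at the crest has slope at least the
  -- limiting vertical derivative `2(r - hp)`.
  have hcmp : ∀ k m', (∀ p ∈ closedFluid η, k * p.2 + m' ≤ verticalFlux u v p) →
      k * hp + m' = m → 2 * (r - hp) ≤ k := by
    intro k m' hk hkm
    refine le_of_forall_small_le_add_mul (K := 4 * C ^ 2) (t₀ := 1 / C) (by positivity)
      fun t ht ht' => ?_
    have h1 : k * (hp - t) + m' ≤ m - 2 * (r - hp) * t + 4 * C ^ 2 * t ^ 2 := by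
      refine le_of_tendsto_of_tendsto' (((hx.sub_const t).const_mul k).add_const m')
        ((hH.sub (hg.mul_const t)).add_const (4 * C ^ 2 * t ^ 2)) fun n => ?_
      have hmem := W.below_top_mem (x n) ht ht'
      have h2 := (abs_le.1 (W.verticalFlux_taylor (W.top_mem (x n)) hmem)).2
      have h3 := hk (x n, η (x n) - t) hmem
      simp only at h3
      linarith
    have h5 : 2 * (r - hp) * t ≤ (k + 4 * C ^ 2 * t) * t := by linarith
    exact le_of_mul_le_mul_right h5 ht
  rcases le_or_gt m 0 with hm' | hm'
  · have := hcmp 0 m (W.affine_le W.verticalFlux_cont (fun p hp => W.verticalFlux_bound hp)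
      (fun p hp => W.verticalFlux_laplacian hp) (fun x => by rwa [verticalFlux_bottom])
      (fun x => by rw [zero_mul, zero_add]; exact htop x)) (by ring)
    linarith
  · have := hcmp (m / hp) 0 (W.affine_le W.verticalFlux_cont
      (fun p hp => W.verticalFlux_bound hp)
      (fun p hp => W.verticalFlux_laplacian hp) (fun x => by rw [verticalFlux_bottom])
      (fun x => by
        rw [add_zero]
        refine le_trans ?_ (htop x)
        rw [div_mul_eq_mul_div, div_le_iff₀ hp0]
        exact mul_le_mul_of_nonneg_left (hlep x) hm'.le)) (by field_simp; ring)
    -- With `c ≤ 0` this reads `2hp(r - hp) ≤ (r - hp)²`, contradicting `hp < r < 3hp`.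
    rw [le_div_iff₀ hp0, hm_def] at this
    nlinarith [mul_pos (sub_pos.2 hσ) (sub_pos.2 h3)]


/-! ### Far-field limits of solitary waves. -/

/-- Where the surface is nearly flat on a long interval, the stream function is nearly that of a
uniform stream. -/
theorem abs_psi_sub_le_of_window (W : IsWave r C ψ u v η η') {d δ L x₀ : ℝ} (hd : 0 < d)
    (hδ : 0 ≤ δ) (hL : 0 < L) (hη : ∀ x, |x - x₀| ≤ L → |η x - d| ≤ δ) {y : ℝ}
    (hy : y ∈ Icc 0 (η x₀)) :
    |ψ (x₀, y) - y / d| ≤ δ / d + (C + r / d) / L ^ 2 * r ^ 2 := by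
  have hr : 0 < r := (W.depth_pos 0).trans_le (W.surface_le 0)
  have hC := W.bound_pos
  set A := C + r / d with hA
  have hA0 : 0 < A := by positivity
  -- The harmonic barrier `κ((x - x₀)² + r² - y²)` reaches the a priori bound `A` of `|ψ - y/d|` on
  -- the lateral sides, while `δ/d` covers the surface error.
  set κ := A / L ^ 2 with hκ
  have hκ0 : 0 < κ := by positivity
  have hκL : κ * L ^ 2 = A := by rw [hκ]; field_simp
  have main : ∀ s : ℝ, s = 1 ∨ s = -1 → s * (ψ (x₀, y) - y / d) ≤ δ / d + κ * r ^ 2 := by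
    intro s hs
    have hs1 : |s| = 1 := by rcases hs with rfl | rfl <;> simp
    have hsle : ∀ t : ℝ, s * t ≤ |t| := fun t => by
      have := le_abs_self (s * t)
      rwa [abs_mul, hs1, one_mul] at this
    have hquad : ∀ p ∈ closedFluid η, 0 ≤ r ^ 2 - p.2 ^ 2 := fun p hp => by
      have := hp.2.trans (W.surface_le p.1)
      nlinarith [hp.1]
    have e : ∀ p : ℝ × ℝ, s * ψ p + (-κ * p.1 ^ 2 + (2 * κ * x₀) * p.1 + κ * p.2 ^ 2 +
        (-s / d) * p.2 + (-κ * x₀ ^ 2 - κ * r ^ 2 - δ / d)) =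
        s * (ψ p - p.2 / d) - δ / d - κ * ((p.1 - x₀) ^ 2 + (r ^ 2 - p.2 ^ 2)) := fun p => by
      ring
    have hbd : ∀ p ∈ closedFluid η, s * (ψ p - p.2 / d) ≤ A := fun p hp => by
      refine (hsle _).trans ((abs_sub _ _).trans (add_le_add (W.psi_bound p hp) ?_))
      rw [abs_of_nonneg (div_nonneg hp.1 hd.le)]
      exact div_le_div_of_nonneg_right (hp.2.trans (W.surface_le _)) hd.le
    have hδd : 0 ≤ δ / d := by positivity
    have habs : Continuous fun p : ℝ × ℝ => |p.1 - x₀| := by fun_prop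
    have key := nonpos_of_laplacian_nonneg (D := closedFluid η ∩ {p : ℝ × ℝ | |p.1 - x₀| ≤ L})
      (U := fluid η ∩ {p : ℝ × ℝ | |p.1 - x₀| < L})
      (w := fun p => s * ψ p + (-κ * p.1 ^ 2 + (2 * κ * x₀) * p.1 + κ * p.2 ^ 2 +
        (-s / d) * p.2 + (-κ * x₀ ^ 2 - κ * r ^ 2 - δ / d)))
      (R := r) (A := A)
      ((isClosed_closedFluid W.continuous_surface).inter (isClosed_le habs continuous_const))
      ((isOpen_fluid W.continuous_surface).inter (isOpen_lt habs continuous_const))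
      (fun p hp => ⟨fluid_subset η hp.1, show |p.1 - x₀| ≤ L from le_of_lt hp.2⟩)
      (fun p hp => by
        rw [abs_of_nonneg hp.1.1]; exact hp.1.2.trans (W.surface_le _))
      ((continuousOn_const.mul (W.psi_cont.mono inter_subset_left)).add
        (Continuous.continuousOn (by fun_prop)))
      (fun p hp => by
        rw [e]
        have h1 := hbd p hp.1
        have h2 := mul_nonneg hκ0.le (add_nonneg (sq_nonneg (p.1 - x₀)) (hquad p hp.1))
        linarith)
      (fun p hp hpU => by
        rw [e]
        have h1 := mul_nonneg hκ0.le (hquad p hp.1)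
        have h2 := mul_nonneg hκ0.le (sq_nonneg (p.1 - x₀))
        rcases hp.1.1.eq_or_lt with h0 | h0
        · have h3 : ψ p = 0 := by
            have := W.bottom p.1
            rwa [show (p.1, (0 : ℝ)) = p from Prod.ext rfl h0] at this
          rw [h3, ← h0, zero_div, sub_zero, mul_zero]
          rw [← h0] at h1
          linarith
        rcases hp.1.2.eq_or_lt with h3 | h3
        · have h4 : ψ p = 1 := by
            have := W.top p.1
            rwa [show (p.1, η p.1) = p from Prod.ext rfl h3.symm] at this
          have h5 := hsle (1 - η p.1 / d)
          have h6 : |1 - η p.1 / d| ≤ δ / d := by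
            rw [one_sub_div hd.ne', abs_div, abs_of_pos hd, abs_sub_comm]
            exact div_le_div_of_nonneg_right (hη _ hp.2) hd.le
          rw [h3] at h1
          rw [h4, h3]
          linarith
        · have h4 : |p.1 - x₀| = L := le_antisymm hp.2 (not_lt.1 fun h => hpU ⟨⟨h0, h3⟩, h⟩)
          have h5 := hbd p hp.1
          rw [← sq_abs, h4, mul_add, hκL]
          linarith)
      (fun p hp => ⟨_, le_of_eq (by ring), ((W.psi_laplacian hp.1).const_mul s).add
        (hasLaplacianAt_quadratic _ _ _ _ _ p)⟩)
    have := key (x₀, y) ⟨hy, by simp [hL.le]⟩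
    rw [e] at this
    simp only [sub_self] at this
    nlinarith [mul_nonneg hκ0.le (sq_nonneg y)]
  rw [abs_le]
  constructor
  · linarith [main (-1) (Or.inr rfl)]
  · linarith [main 1 (Or.inl rfl)]

theorem eventually_abs_psi_sub_le (W : IsWave r C ψ u v η η') {d ε : ℝ} (hd : 0 < d)
    (hη : Tendsto η atTop (𝓝 d)) (hε : 0 < ε) :
    ∀ᶠ x in atTop, ∀ y ∈ Icc 0 (η x), |ψ (x, y) - y / d| ≤ ε := by
  have hL : Tendsto (fun L : ℝ => (C + r / d) / L ^ 2 * r ^ 2) atTop (𝓝 0) := by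
    have h1 : Tendsto (fun L : ℝ => L ^ 2) atTop atTop := tendsto_pow_atTop two_ne_zero
    simpa using (h1.const_div_atTop (C + r / d)).mul_const (r ^ 2)
  obtain ⟨L, hL1, hL2⟩ := ((hL.eventually_le_const (half_pos hε)).and
    (eventually_gt_atTop 0)).exists
  have hδ : 0 < ε / 2 * d := by positivity
  obtain ⟨X, hX⟩ := eventually_atTop.1 (Metric.tendsto_nhds.1 hη _ hδ)
  filter_upwards [eventually_ge_atTop (X + L)] with x hx y hy
  refine (W.abs_psi_sub_le_of_window hd hδ.le hL2 (fun z hz => ?_) hy).trans ?_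
  · have := hX z (by linarith [(abs_le.1 hz).1])
    rw [Real.dist_eq] at this
    exact this.le
  · rw [mul_div_assoc, div_self hd.ne', mul_one]
    linarith

/-- Closeness of `ψ` passes to `u` through a difference quotient, since `u` is uniformly Lipschitz
in `y`. -/
theorem eventually_abs_u_sub_le (W : IsWave r C ψ u v η η') {d ε : ℝ} (hd : 0 < d)
    (hη : Tendsto η atTop (𝓝 d)) (hε : 0 < ε) :
    ∀ᶠ x in atTop, ∀ y ∈ Icc 0 (η x), |u (x, y) - 1 / d| ≤ ε := by
  have hC := W.bound_pos
  -- The Taylor error is at most `ε/2` after division by `t`. The minimum with `1` makes `t` at most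
  -- half the depth, so a step up or down stays in the column.
  set t := min ε 1 / (2 * C) with ht
  have ht0 : 0 < t := by positivity
  have ht1 : C * t ≤ ε / 2 := by
    have : C * t = min ε 1 / 2 := by rw [ht]; field_simp
    rw [this]; linarith [min_le_left ε 1]
  have ht2 : t ≤ 1 / C / 2 := by
    rw [ht, div_div, mul_comm C 2]
    exact div_le_div_of_nonneg_right (min_le_right _ _) (by positivity)
  filter_upwards [W.eventually_abs_psi_sub_le hd hη (show 0 < ε * t / 4 by positivity)]
    with x hx a ha
  have hb : ∃ b ∈ Icc 0 (η x), |b - a| = t := by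
    have h1 := W.inv_bound_le_surface x
    rcases le_total a (η x / 2) with h2 | h2
    · exact ⟨a + t, ⟨by linarith [ha.1], by linarith⟩, by rw [add_sub_cancel_left, abs_of_pos ht0]⟩
    · exact ⟨a - t, ⟨by linarith, by linarith [ha.2]⟩, by
        rw [sub_sub_cancel_left, abs_neg, abs_of_pos ht0]⟩
  obtain ⟨b, hb, hbt⟩ := hb
  have h1 := W.psi_taylor ha hb
  have h2 := hx a ha
  have h3 := hx b hb
  rw [← sq_abs (b - a), hbt] at h1
  have h4 : |(u (x, a) - 1 / d) * (b - a)| ≤ C * t ^ 2 + (ε * t / 4 + ε * t / 4) := by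
    have e : (u (x, a) - 1 / d) * (b - a) =
        -(ψ (x, b) - ψ (x, a) - u (x, a) * (b - a)) +
          ((ψ (x, b) - b / d) - (ψ (x, a) - a / d)) := by ring
    rw [e]
    refine (abs_add_le _ _).trans (add_le_add (by rwa [abs_neg]) ((abs_sub _ _).trans
      (add_le_add h3 h2)))
  rw [abs_mul, hbt] at h4
  have h5 : |u (x, a) - 1 / d| * t ≤ ε * t := by nlinarith
  exact le_of_mul_le_mul_right h5 ht0

theorem verticalFlux_top_le (W : IsWave r C ψ u v η η') {x m : ℝ}
    (hm : ∀ y ∈ Icc 0 (η x), |u (x, y)| ≤ m) : verticalFlux u v (x, η x) ≤ η x * m ^ 2 := by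
  have h1 : verticalFlux u v (x, η x) ≤ ∫ _ in (0 : ℝ)..(η x), m ^ 2 := by
    refine intervalIntegral.integral_mono_on (W.depth_pos x).le
      ((vertical_continuousOn W.flux_density_cont x).intervalIntegrable_of_Icc (W.depth_pos x).le)
      intervalIntegrable_const fun y hy => ?_
    have := sq_le_sq' (abs_le.1 (hm y hy)).1 (abs_le.1 (hm y hy)).2
    nlinarith [sq_nonneg (v (x, y))]
  simpa using h1

/-- A solitary wave on a stream of depth `d` satisfies `1 < 4 d³`. -/
theorem depth_bound_of_tendsto (W : IsWave r C ψ u v η η') {c d : ℝ} (hc0 : 0 < c)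
    (hc : ∀ x, verticalFlux u v (x, η x) = c + (r - η x) ^ 2) (hη : Tendsto η atTop (𝓝 d)) :
    0 < d ∧ 1 < 4 * d ^ 3 := by
  have hC := W.bound_pos
  have hd : 0 < d := (by positivity : 0 < 1 / C).trans_le
    (ge_of_tendsto' hη W.inv_bound_le_surface)
  have hu := fun ε (hε : 0 < ε) => W.eventually_abs_u_sub_le hd hη hε
  have h1 : ∀ ε > 0, c + (r - d) ^ 2 ≤ d * (1 / d + ε) ^ 2 := fun ε hε => by
    refine le_of_tendsto_of_tendsto (((hη.const_sub r).pow 2).const_add c)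
      (hη.mul_const ((1 / d + ε) ^ 2)) ?_
    filter_upwards [hu ε hε] with x hx
    rw [← hc]
    refine W.verticalFlux_top_le fun y hy => ?_
    have h2 := abs_sub_abs_le_abs_sub (u (x, y)) (1 / d)
    rw [abs_of_pos (show 0 < 1 / d by positivity)] at h2
    linarith [hx y hy]
  have h2 : c + (r - d) ^ 2 ≤ 1 / d := by
    have : Tendsto (fun ε : ℝ => d * (1 / d + ε) ^ 2) (𝓝[>] 0) (𝓝 (1 / d)) := by
      have h : Continuous (fun ε : ℝ => d * (1 / d + ε) ^ 2) := by fun_prop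
      have h' := (h.tendsto 0).mono_left (nhdsWithin_le_nhds (s := Ioi 0))
      have e : d * (1 / d + 0) ^ 2 = 1 / d := by field_simp; ring
      rwa [e] at h'
    refine ge_of_tendsto this ?_
    filter_upwards [self_mem_nhdsWithin] with ε hε using h1 ε hε
  have h3 : (1 / d) ^ 2 ≤ 2 * (r - d) := by
    have hut : Tendsto (fun x => u (x, η x)) atTop (𝓝 (1 / d)) := by
      refine Metric.tendsto_nhds.2 fun ε hε => ?_
      filter_upwards [hu (ε / 2) (half_pos hε)] with x hx
      rw [Real.dist_eq]
      exact (hx _ (W.top_mem x)).trans_lt (half_lt_self hε)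
    refine le_of_tendsto_of_tendsto' (hut.pow 2) ((hη.const_sub r).const_mul 2) fun x => ?_
    rw [← W.bernoulli]
    nlinarith [sq_nonneg (v (x, η x))]
  refine ⟨hd, ?_⟩
  have h4 : ((1 / d) ^ 2) ^ 2 ≤ (2 * (r - d)) ^ 2 := pow_le_pow_left₀ (by positivity) h3 2
  -- `1/d⁴ ≤ 4(r - d)² < 4(c + (r - d)²) ≤ 4/d`; strictness is exactly `c > 0`.
  have h5 : 1 / d ^ 4 < 4 / d := by
    have : ((1 / d) ^ 2) ^ 2 = 1 / d ^ 4 := by rw [← pow_mul, div_pow, one_pow]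
    rw [this] at h4
    have : 4 / d = 4 * (1 / d) := by ring
    linarith
  rw [div_lt_div_iff₀ (by positivity) hd] at h5
  have h6 : 1 * d < 4 * d ^ 3 * d := by linarith
  exact lt_of_mul_lt_mul_right h6 hd.le

end IsWave

/-! ### Froude numbers and laminar flows. -/

theorem froude_pos {d : ℝ} (hd : 0 < d) : 0 < froude d := Real.rpow_pos_of_pos hd _

theorem froude_sq_mul {d : ℝ} (hd : 0 < d) : froude d ^ 2 * d ^ 3 = 1 := by
  rw [froude, ← Real.rpow_natCast (d ^ _), ← Real.rpow_natCast d, ← Real.rpow_mul hd.le,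
    ← Real.rpow_add hd]
  norm_num

theorem froude_lt_two_iff {d : ℝ} (hd : 0 < d) : froude d < 2 ↔ 1 < 4 * d ^ 3 := by
  have h1 := froude_sq_mul hd
  have h2 := froude_pos hd
  have h3 : 0 < d ^ 3 := by positivity
  constructor
  · intro h
    have : froude d ^ 2 < 4 := by nlinarith
    nlinarith
  · intro h
    by_contra! hcon
    have : 4 ≤ froude d ^ 2 := by nlinarith
    nlinarith

theorem froude_eq_two_iff {d : ℝ} (hd : 0 < d) : froude d = 2 ↔ 4 * d ^ 3 = 1 := by
  have h1 := froude_sq_mul hd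
  have h2 := froude_pos hd
  have h3 : 0 < d ^ 3 := by positivity
  constructor
  · intro h
    rw [h] at h1
    linarith
  · intro h
    have h4 : froude d ^ 2 = 2 ^ 2 := by
      have : froude d ^ 2 * d ^ 3 = 2 ^ 2 * d ^ 3 := by rw [h1]; linarith
      exact mul_right_cancel₀ h3.ne' this
    exact (sq_eq_sq₀ h2.le two_pos.le).1 h4

theorem laminarFlowForce_eq {r d : ℝ} (hd : 0 < d) :
    laminarFlowForce r d = 1 / (2 * d) - d ^ 2 / 2 + r * d := by
  have hU : UniqueDiffOn ℝ (closedFluid fun _ => d) :=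
    uniqueDiffOn_closedFluid (fun _ => hd) (fun x => hasDerivAt_const x d)
  have hf : ∀ p ∈ closedFluid fun _ => d, fderivWithin ℝ (fun p : ℝ × ℝ => p.2 / d)
      (closedFluid fun _ => d) p = d⁻¹ • ContinuousLinearMap.snd ℝ ℝ ℝ := fun p hp => by
    have h : HasFDerivAt (fun p : ℝ × ℝ => p.2 / d) (d⁻¹ • ContinuousLinearMap.snd ℝ ℝ ℝ) p := by
      simpa [div_eq_inv_mul] using (hasFDerivAt_snd (𝕜 := ℝ) (p := p)).const_mul d⁻¹
    exact h.hasFDerivWithinAt.fderivWithin (hU p hp)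
  have e : laminarFlowForce r d = ∫ y in (0 : ℝ)..d, ((1 / 2) * d⁻¹ ^ 2 + r - y) := by
    refine intervalIntegral.integral_congr fun y hy => ?_
    rw [uIcc_of_le hd.le] at hy
    simp only [partialX, partialY, hf (0, y) hy]
    simp
    ring
  rw [e, intervalIntegral.integral_sub intervalIntegrable_const
    (continuous_id'.intervalIntegrable _ _), integral_id, intervalIntegral.integral_const]
  simp only [smul_eq_mul]
  field_simp
  ring

/-- Eliminating `r = d + 1/(2d²)` makes the difference a function of the depth alone, with the sign
of `4d³ - 1`. -/
theorem laminarFlowForce_sub {r d : ℝ} (hd : d ∈ laminarDepths r) :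
    laminarFlowForce r d - r ^ 2 / 2 = 1 / (2 * d) - 1 / (8 * d ^ 4) := by
  obtain ⟨h0, rfl⟩ := hd
  rw [laminarFlowForce_eq h0]
  field_simp
  ring

theorem laminarFlowForce_sub_eq_div {r d : ℝ} (hd : d ∈ laminarDepths r) :
    laminarFlowForce r d - r ^ 2 / 2 = (4 * d ^ 3 - 1) / (8 * d ^ 4) := by
  have h0 := hd.1
  rw [laminarFlowForce_sub hd]
  field_simp
  ring

theorem mem_laminarDepths_iff {r d : ℝ} (hd : 0 < d) :
    d ∈ laminarDepths r ↔ 1 + 2 * d ^ 3 = 2 * r * d ^ 2 := by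
  have h : 1 / (2 * d ^ 2) + d = (1 + 2 * d ^ 3) / (2 * d ^ 2) := by field_simp
  rw [laminarDepths, mem_ofPred_eq, h, div_eq_iff (by positivity)]
  exact ⟨fun h => by linarith [h.2], fun h => ⟨hd, by linarith⟩⟩

/-- Eliminating `r` between the two cubic equations leaves the factor `d - e`. The second
alternative forces `d = e = 1` when both depths lie on the same side of `1`, hence uniqueness on
each side. -/
theorem laminarDepths_eq_or {r d e : ℝ} (hd : d ∈ laminarDepths r) (he : e ∈ laminarDepths r) :
    d = e ∨ d + e = 2 * (d * e) ^ 2 := by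
  have h1 := (mem_laminarDepths_iff hd.1).1 hd
  have h2 := (mem_laminarDepths_iff he.1).1 he
  have : (d - e) * (d + e - 2 * (d * e) ^ 2) = 0 := by
    linear_combination d ^ 2 * h2 - e ^ 2 * h1
  rcases mul_eq_zero.1 this with h | h
  · exact Or.inl (sub_eq_zero.1 h)
  · exact Or.inr (sub_eq_zero.1 h)

theorem laminarDepths_unique_le {r d e : ℝ} (hd : d ∈ laminarDepths r)
    (he : e ∈ laminarDepths r) (hd1 : d ≤ 1) (he1 : e ≤ 1) : d = e := by
  rcases laminarDepths_eq_or hd he with h | h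
  · exact h
  have hd0 := hd.1
  have he0 := he.1
  have h1 : d * e ≤ d := mul_le_of_le_one_right hd0.le he1
  have h2 : d * e ≤ e := mul_le_of_le_one_left he0.le hd1
  have h3 : (d * e) ^ 2 ≤ d * e := by nlinarith [mul_pos hd0 he0]
  linarith

theorem laminarDepths_unique_ge {r d e : ℝ} (hd : d ∈ laminarDepths r)
    (he : e ∈ laminarDepths r) (hd1 : 1 ≤ d) (he1 : 1 ≤ e) : d = e := by
  rcases laminarDepths_eq_or hd he with h | h
  · exact h
  have hd0 := hd.1
  have he0 := he.1
  have h1 : d ≤ d * e := le_mul_of_one_le_right hd0.le he1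
  have h2 : e ≤ d * e := le_mul_of_one_le_left he0.le hd1
  have h3 : d * e ≤ (d * e) ^ 2 := by nlinarith
  linarith

theorem one_mem_laminarDepths_imp {r : ℝ} (h : 1 ∈ laminarDepths r) : r = 3 / 2 := by
  have := h.2
  norm_num at this
  linarith

theorem laminarDepths_spec {r : ℝ} (hr : 3 / 2 ≤ r) :
    laminarDepths r = {depthMinus r, depthPlus r} ∧ 0 < depthMinus r ∧ depthMinus r ≤ 1 ∧
      1 ≤ depthPlus r := by
  set f : ℝ → ℝ := fun d => 1 + 2 * d ^ 3 - 2 * r * d ^ 2 with hf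
  have hfc : Continuous f := by rw [hf]; fun_prop
  have hr0 : 0 < r := by linarith
  have h1 : f 1 ≤ 0 := by simp only [hf]; linarith
  obtain ⟨a, ha, ha'⟩ : (0 : ℝ) ∈ f '' Icc 0 1 :=
    intermediate_value_Icc' zero_le_one hfc.continuousOn ⟨h1, by norm_num [hf]⟩
  obtain ⟨b, hb, hb'⟩ : (0 : ℝ) ∈ f '' Icc 1 r :=
    intermediate_value_Icc (by linarith) hfc.continuousOn
      ⟨h1, by simp only [hf]; ring_nf; norm_num⟩
  have ha0 : 0 < a := ha.1.lt_of_ne (by rintro rfl; norm_num [hf] at ha')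
  have hb0 : 0 < b := by linarith [hb.1]
  have hma : a ∈ laminarDepths r := (mem_laminarDepths_iff ha0).2 (by
    simp only [hf] at ha'; linarith)
  have hmb : b ∈ laminarDepths r := (mem_laminarDepths_iff hb0).2 (by
    simp only [hf] at hb'; linarith)
  have hset : laminarDepths r = {a, b} := by
    ext d
    simp only [mem_insert_iff, mem_singleton_iff]
    constructor
    · intro hd
      rcases le_total d 1 with h | h
      · exact Or.inl (laminarDepths_unique_le hd hma h ha.2)
      · exact Or.inr (laminarDepths_unique_ge hd hmb h hb.1)
    · rintro (rfl | rfl) <;> assumption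
  have hab : a ≤ b := ha.2.trans hb.1
  have e1 : depthMinus r = a := by rw [depthMinus, hset, csInf_pair, inf_eq_left.2 hab]
  have e2 : depthPlus r = b := by rw [depthPlus, hset, csSup_pair, sup_eq_right.2 hab]
  rw [e1, e2]
  exact ⟨hset, ha0, ha.2, hb.1⟩

theorem depthMinus_mem {r : ℝ} (hr : 3 / 2 ≤ r) : depthMinus r ∈ laminarDepths r := by
  have h := (laminarDepths_spec hr).1
  have h' : depthMinus r ∈ ({depthMinus r, depthPlus r} : Set ℝ) := mem_insert _ _
  rwa [← h] at h'

theorem depthPlus_mem {r : ℝ} (hr : 3 / 2 ≤ r) : depthPlus r ∈ laminarDepths r := by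
  have h := (laminarDepths_spec hr).1
  have h' : depthPlus r ∈ ({depthMinus r, depthPlus r} : Set ℝ) := by simp
  rwa [← h] at h'

theorem flowForceMinus_eq_iff {r : ℝ} (hr : 3 / 2 ≤ r) :
    flowForceMinus r = r ^ 2 / 2 ↔ 4 * depthMinus r ^ 3 = 1 := by
  have hm := depthMinus_mem hr
  have h0 := hm.1
  rw [← sub_eq_zero, flowForceMinus, laminarFlowForce_sub_eq_div hm, div_eq_zero_iff,
    or_iff_left (by positivity), sub_eq_zero]

theorem lt_flowForceMinus_iff {r : ℝ} (hr : 3 / 2 ≤ r) :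
    r ^ 2 / 2 < flowForceMinus r ↔ 1 < 4 * depthMinus r ^ 3 := by
  have hm := depthMinus_mem hr
  have h0 := hm.1
  rw [← sub_pos, flowForceMinus, laminarFlowForce_sub_eq_div hm,
    div_pos_iff_of_pos_right (by positivity), sub_pos]

theorem existsUnique_flowForceMinus_eq :
    ∃! r : ℝ, 3 / 2 ≤ r ∧ flowForceMinus r = r ^ 2 / 2 := by
  obtain ⟨d, hd, hd3⟩ : ∃ d : ℝ, 0 < d ∧ 4 * d ^ 3 = 1 := by
    refine ⟨(1 / 4 : ℝ) ^ (1 / 3 : ℝ), by positivity, ?_⟩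
    rw [← Real.rpow_natCast, ← Real.rpow_mul (by norm_num)]
    norm_num
  have hinj : ∀ e : ℝ, 0 < e → 4 * e ^ 3 = 1 → e = d := fun e he he3 =>
    (pow_left_inj₀ he.le hd.le three_ne_zero).1 (by linarith)
  have hd1 : d ≤ 1 := by
    by_contra! h
    nlinarith [one_lt_pow₀ h three_ne_zero]
  have hmem : d ∈ laminarDepths (1 / (2 * d ^ 2) + d) := ⟨hd, rfl⟩
  -- The depth with `4d³ = 1` fixes `r`; the double root of `r - 3/2` at `d = 1` shows that `r` is
  -- admissible.
  have hr : 3 / 2 ≤ 1 / (2 * d ^ 2) + d := by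
    have h : 1 / (2 * d ^ 2) + d - 3 / 2 = (d - 1) ^ 2 * (2 * d + 1) / (2 * d ^ 2) := by
      field_simp; ring
    have : 0 ≤ (d - 1) ^ 2 * (2 * d + 1) / (2 * d ^ 2) := by positivity
    linarith
  refine ⟨1 / (2 * d ^ 2) + d, ⟨hr, ?_⟩, ?_⟩
  · rw [flowForceMinus_eq_iff hr, ← laminarDepths_unique_le hmem (depthMinus_mem hr) hd1
      (laminarDepths_spec hr).2.2.1, hd3]
  · rintro s ⟨hs, hs'⟩
    have hms := depthMinus_mem hs
    have h := hinj _ hms.1 ((flowForceMinus_eq_iff hs).1 hs')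
    rw [h] at hms
    exact hms.2.symm

theorem depthPlus_lower {r : ℝ} (hr : 3 / 2 ≤ r) : 2 * r ≤ 3 * depthPlus r := by
  obtain ⟨h0, h⟩ := depthPlus_mem hr
  have h1 := (laminarDepths_spec hr).2.2.2
  have : 1 / (2 * depthPlus r ^ 2) ≤ 1 / 2 :=
    one_div_le_one_div_of_le two_pos (by nlinarith)
  linarith

theorem lt_flowForcePlus {r : ℝ} (hr : 3 / 2 ≤ r) : r ^ 2 / 2 < flowForcePlus r := by
  have hm := depthPlus_mem hr
  have h0 := hm.1
  have h1 := (laminarDepths_spec hr).2.2.2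
  rw [← sub_pos, flowForcePlus, laminarFlowForce_sub_eq_div hm]
  have := one_le_pow₀ h1 (n := 3)
  exact div_pos (by linarith) (by positivity)

theorem abs_flowForcePlus_sub_le {r : ℝ} (hr : 3 / 2 ≤ r) :
    |flowForcePlus r - (r ^ 2 / 2 + 1 / (2 * r))| ≤ 1 / r ^ 2 := by
  have hm := depthPlus_mem hr
  have hlow := depthPlus_lower hr
  have h1 := (laminarDepths_spec hr).2.2.2
  have hF : flowForcePlus r - r ^ 2 / 2 = _ := laminarFlowForce_sub hm
  set b := depthPlus r
  have hb := hm.1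
  have hr0 : 0 < r := by linarith
  -- Replacing `1/(2b)` by `1/(2r)` costs `(r - b)/(2br)`, and `r - b = 1/(2b²)`. Since `b ≥ 2r/3`,
  -- both error terms are `O(r⁻⁴)`; the bound `1/r²` suffices.
  have e : flowForcePlus r - (r ^ 2 / 2 + 1 / (2 * r)) =
      1 / (4 * b ^ 3 * r) - 1 / (8 * b ^ 4) := by
    have h2 : 1 / (2 * b) - 1 / (2 * r) = 1 / (4 * b ^ 3 * r) := by
      have h3 : 1 / (2 * b) - 1 / (2 * r) = (r - b) / (2 * b * r) := by field_simp
      have h4 : r - b = 1 / (2 * b ^ 2) := by linarith [hm.2]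
      rw [h3, h4]
      field_simp
      norm_num
    linarith
  have h2 : 1 / (4 * b ^ 3 * r) ≤ 1 / r ^ 2 := by
    refine one_div_le_one_div_of_le (by positivity) ?_
    have : b ≤ b ^ 3 := le_self_pow₀ h1 three_ne_zero
    nlinarith
  have h3 : 1 / (8 * b ^ 4) ≤ 1 / r ^ 2 := by
    refine one_div_le_one_div_of_le (by positivity) ?_
    have : b ^ 2 ≤ b ^ 4 := pow_le_pow_right₀ h1 (by norm_num)
    nlinarith
  rw [e, abs_le]
  have h4 : 0 < 1 / (4 * b ^ 3 * r) := by positivity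
  have h5 : 0 < 1 / (8 * b ^ 4) := by positivity
  constructor <;> linarith

theorem flowForcePlus_isBigO :
    (fun r : ℝ => flowForcePlus r - (r ^ 2 / 2 + 1 / (2 * r)))
      =O[atTop] (fun r : ℝ => 1 / r ^ 2) := by
  refine IsBigO.of_bound 1 ?_
  filter_upwards [eventually_ge_atTop (3 / 2)] with r hr
  rw [Real.norm_eq_abs, Real.norm_eq_abs, one_mul, abs_of_nonneg (show 0 ≤ 1 / r ^ 2 by positivity)]
  exact abs_flowForcePlus_sub_le hr

theorem flowForcePlus_sub_tendsto :
    Tendsto (fun r : ℝ => flowForcePlus r - r ^ 2 / 2) atTop (𝓝 0) := by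
  have h1 : Tendsto (fun r : ℝ => 1 / r ^ 2) atTop (𝓝 0) := by
    have := (tendsto_pow_atTop (α := ℝ) two_ne_zero).const_div_atTop 1
    simpa using this
  have h2 : Tendsto (fun r : ℝ => 1 / (2 * r)) atTop (𝓝 0) :=
    (tendsto_id.const_mul_atTop two_pos).const_div_atTop 1
  have h3 := (flowForcePlus_isBigO.trans_tendsto h1).add h2
  rw [add_zero] at h3
  refine h3.congr fun r => ?_
  ring

/-! ### Conclusions for solutions in the regularity class. -/

theorem SteadyWave.IsSolution.exists_flowForce {γ : ℝ≥0} {r : ℝ} {ψ : ℝ × ℝ → ℝ} {η : ℝ → ℝ}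
    (hψ : MemC2Holder γ (closedFluid η) ψ) (hη : MemC2Holder γ univ η)
    (h : IsSolution r ψ η) (hlam : ¬ IsLaminar ψ η) :
    ∃ 𝓕 : ℝ, (∀ x, flowForce r ψ η x = 𝓕) ∧ r ^ 2 / 2 < 𝓕 := by
  obtain ⟨C, W⟩ := h.exists_isWave hψ hη
  obtain ⟨c, hc⟩ := W.exists_verticalFlux_top
  have hpos := W.verticalFlux_const_pos hlam hc
  refine ⟨c / 2 + r ^ 2 / 2, fun x => ?_, by linarith⟩
  rw [flowForce_eq_verticalFlux W, hc]
  ring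

theorem SteadyWave.IsSolution.froude_lt_two {γ : ℝ≥0} {r d : ℝ} {ψ : ℝ × ℝ → ℝ} {η : ℝ → ℝ}
    (hψ : MemC2Holder γ (closedFluid η) ψ) (hη : MemC2Holder γ univ η)
    (h : IsSolution r ψ η) (hlam : ¬ IsLaminar ψ η) (hd : Tendsto η (cocompact ℝ) (𝓝 d)) :
    0 < d ∧ froude d < 2 := by
  obtain ⟨C, W⟩ := h.exists_isWave hψ hη
  obtain ⟨c, hc⟩ := W.exists_verticalFlux_top
  obtain ⟨h0, h1⟩ := W.depth_bound_of_tendsto (W.verticalFlux_const_pos hlam hc) hc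
    (hd.mono_left atTop_le_cocompact)
  exact ⟨h0, (froude_lt_two_iff h0).2 h1⟩

theorem theorem1 :
    -- the lower bound for the flow force of every solution that is not laminar
    (∀ (γ : ℝ≥0) (r : ℝ) (ψ : ℝ × ℝ → ℝ) (η : ℝ → ℝ), 0 < γ → γ < 1 →
      SteadyWave.MemC2Holder γ (SteadyWave.closedFluid η) ψ →
      SteadyWave.MemC2Holder γ Set.univ η →
      SteadyWave.IsSolution r ψ η → ¬ SteadyWave.IsLaminar ψ η →
      ∃ 𝓕 : ℝ, (∀ x, SteadyWave.flowForce r ψ η x = 𝓕) ∧ r ^ 2 / 2 < 𝓕) ∧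
    -- the laminar depths and the two boundary curves are well defined for `r ≥ 3 / 2`
    (∀ r : ℝ, 3 / 2 ≤ r →
      SteadyWave.laminarDepths r = {SteadyWave.depthMinus r, SteadyWave.depthPlus r} ∧
      0 < SteadyWave.depthMinus r ∧ SteadyWave.depthMinus r ≤ 1 ∧ 1 ≤ SteadyWave.depthPlus r ∧
      (3 / 2 < r → SteadyWave.depthMinus r < 1 ∧ 1 < SteadyWave.depthPlus r)) ∧
    -- the barrier meets the supercritical boundary exactly where the Froude number is two
    (∃! r : ℝ, 3 / 2 ≤ r ∧ SteadyWave.flowForceMinus r = r ^ 2 / 2) ∧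
    (∀ r : ℝ, 3 / 2 ≤ r →
      (SteadyWave.flowForceMinus r = r ^ 2 / 2 ↔
        SteadyWave.froude (SteadyWave.depthMinus r) = 2) ∧
      (r ^ 2 / 2 < SteadyWave.flowForceMinus r ↔
        SteadyWave.froude (SteadyWave.depthMinus r) < 2)) ∧
    -- the bound for the Froude number of solitary waves
    (∀ (γ : ℝ≥0) (r d : ℝ) (ψ : ℝ × ℝ → ℝ) (η : ℝ → ℝ), 0 < γ → γ < 1 →
      SteadyWave.MemC2Holder γ (SteadyWave.closedFluid η) ψ →
      SteadyWave.MemC2Holder γ Set.univ η →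
      SteadyWave.IsSolution r ψ η → ¬ SteadyWave.IsLaminar ψ η →
      Tendsto η (cocompact ℝ) (𝓝 d) → 0 < d ∧ SteadyWave.froude d < 2) ∧
    -- the barrier lies below the subcritical boundary for large `r` and is asymptotic to it
    (∀ᶠ r : ℝ in atTop, r ^ 2 / 2 < SteadyWave.flowForcePlus r) ∧
    Tendsto (fun r : ℝ => SteadyWave.flowForcePlus r - r ^ 2 / 2) atTop (𝓝 0) ∧
    (fun r : ℝ => SteadyWave.flowForcePlus r - (r ^ 2 / 2 + 1 / (2 * r)))
      =O[atTop] (fun r : ℝ => 1 / r ^ 2) := by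
  refine ⟨fun γ r ψ η _ _ hψ hη h hlam => h.exists_flowForce hψ hη hlam, fun r hr => ?_,
    existsUnique_flowForceMinus_eq, fun r hr => ?_,
    fun γ r d ψ η _ _ hψ hη h hlam hd => h.froude_lt_two hψ hη hlam hd, ?_,
    flowForcePlus_sub_tendsto, flowForcePlus_isBigO⟩
  · obtain ⟨h1, h2, h3, h4⟩ := laminarDepths_spec hr
    refine ⟨h1, h2, h3, h4, fun hr' => ⟨h3.lt_of_ne fun h => ?_, h4.lt_of_ne fun h => ?_⟩⟩
    · have := depthMinus_mem hr
      rw [h] at this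
      exact hr'.ne' (one_mem_laminarDepths_imp this)
    · have := depthPlus_mem hr
      rw [← h] at this
      exact hr'.ne' (one_mem_laminarDepths_imp this)
  · have h0 := (depthMinus_mem hr).1
    exact ⟨(flowForceMinus_eq_iff hr).trans (froude_eq_two_iff h0).symm,
      (lt_flowForceMinus_iff hr).trans (froude_lt_two_iff h0).symm⟩
  · filter_upwards [eventually_ge_atTop (3 / 2)] with r hr using lt_flowForcePlus hr
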